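/- Let $\mathcal O$ be a complete discrete valuation ring with uniformizer $\pi$ and finite residue field $k$ of cardinality $q$. For an $\mathcal O$-algebra $B$ let $W_{\mathcal O}(B)$ denote the ring of ramified Witt vectors: as a set $W_{\mathcal O}(B)=B^{\mathbb N_0}$, with the unique functorial $\mathcal O$-algebra structure for which all the maps $$\Phi_n\colon W_{\mathcal O}(B)\to B,\qquad \Phi_n(b_0,b_1,\dots)=\sum_{i=0}^n\pi^i b_i^{q^{n-i}}\qquad(n\ge 0)$$ are homomorphisms of $\mathcal O$-algebras. The functor $W_{\mathcal O}$ is represented by a ring scheme $\mathbb W_{\mathcal O}=\mathrm{Spec}\,\mathcal O[X_0,X_1,\dots]$. Let $\mathcal O'/\mathcal O$ be a finite totally ramified extension of discrete valuation rings (i.e. the residue field extension is trivial) of degree $e$, and let $\varpi$ be a uniformizer of $\mathcal O'$. Define $W_{\mathcal O'}$, $\Phi'_n$ and $\mathbb W_{\mathcal O'}$ in the same way from $\mathcal O'$ and $\varpi$. For $\mathcal O'$-algebras $B$, let $u_B\colon W_{\mathcal O}(B)\to W_{\mathcal O'}(B)$ be Drinfeld's homomorphism, i.e. the unique functorial homomorphism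 of $\mathcal O$-algebras with $\Phi'_n(u_B(b))=\Phi_n(b)$ for all $n\ge 0$, and let $$u^{\rm ra}_B=u_B\otimes\mathrm{id}\colon W_{\mathcal O}(B)\otimes_{\mathcal O}\mathcal O'\to W_{\mathcal O'}(B),\qquad \sum_{i=0}^{e-1}b_i\otimes\varpi^i\mapsto\sum_{i=0}^{e-1}u_B(b_i)\,\varpi^i .$$ Since $\mathcal O'=\bigoplus_{i=0}^{e-1}\mathcal O\varpi^i$, the functor $B\mapsto W_{\mathcal O}(B)\otimes_{\mathcal O}\mathcal O'$ on $k$-algebras is represented by a ring scheme $\prod^{\varpi}\mathbb W_{\mathcal O,k}=\mathrm{Spec}\,k[X_{n,i};\,n\in\mathbb N_0,\,0\le i<e]$, where $X_{n,i}$ is the $n$-th Witt component of $b_i$ in $\sum_i b_i\otimes\varpi^i$; let $\mathbb W_{\mathcal O',k}$ be the special fibre of $\mathbb W_{\mathcal O'}$. The homomorphisms $u^{\rm ra}_B$, for $k$-algebras $B$, define a morphism of ring schemes $$\boldsymbol u^{\rm ra}_k\colon \prod^{\varpi}\mathbb W_{\mathcal O,k}\to\mathbb W_{\mathcal O',k}.$$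 Then $\boldsymbol u^{\rm ra}_k$ is a universal homeomorphism. Its kernel, as a homomorphism of additive group schemes over $k$, is pro-infinitesimal (a cofiltered limit of finite $k$-group schemes having only one point) and is isomorphic, as a $k$-scheme, to $$\mathrm{Spec}\Big(k[X_{n,i};\,n\in\mathbb N_0,\,0\le i<e]\,/\,\big(X_{n,i}^{\,q^{n(e-1)+i}};\,n\in\mathbb N_0,\,0\le i<e\big)\Big).$$ -/

import Mathlib

namespace RamWitt

open MvPolynomial IsLocalRing

section Dwork

variable {A : Type*} [CommRing A]

lemma dvd_pow_sub_pow {ϖ a b : A} {q : ℕ} (hq : ϖ ∣ (q : A)) {m : ℕ}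
    (h : ϖ ^ (m + 1) ∣ a - b) (s : ℕ) : ϖ ^ (m + 1 + s) ∣ a ^ q ^ s - b ^ q ^ s := by
  induction s with
  | zero => simpa using h
  | succ s ih =>
    obtain ⟨c, hc⟩ := ih
    obtain ⟨d, hd⟩ := hq
    have ha : a ^ q ^ s = b ^ q ^ s + ϖ ^ (m + 1 + s) * c := by rw [← hc]; ring
    rw [pow_succ q s, pow_mul, pow_mul, ha]
    obtain ⟨k, hk⟩ := Polynomial.powAddExpansion (b ^ q ^ s) (ϖ ^ (m + 1 + s) * c) q
    rw [hk, hd]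
    exact ⟨d * (b ^ q ^ s) ^ (q - 1) * c + k * ϖ ^ (m + s) * c ^ 2, by ring⟩

/-- The solution `b`, constructed recursively, of the system of equations
`∑_{i ≤ n} ϖ ^ i * b i ^ q ^ (n - i) = a n`; see `dworkSol_spec` and `ghost_unique` for existence
and uniqueness in the cases in which it is used. -/
noncomputable def dworkSol (ϖ : A) (q : ℕ) (a : ℕ → A) (n : ℕ) : A :=
  Classical.epsilon fun c =>
    ϖ ^ n * c = a n - ∑ i : Fin n, ϖ ^ (i : ℕ) * dworkSol ϖ q a i ^ q ^ (n - i)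
termination_by n
decreasing_by exact i.2

theorem dworkSol_spec (ϖ : A) (q : ℕ) (hq : ϖ ∣ (q : A)) (σ : A →+* A)
    (hσϖ : σ ϖ = ϖ) (hσ : ∀ x, ϖ ∣ σ x - x ^ q) (a : ℕ → A)
    (ha : ∀ n, ϖ ^ (n + 1) ∣ σ (a n) - a (n + 1)) (n : ℕ) :
    ∑ i ∈ Finset.range (n + 1), ϖ ^ i * dworkSol ϖ q a i ^ q ^ (n - i) = a n := by
  have key : ∀ n, (∃ c, ϖ ^ n * c =
      a n - ∑ i : Fin n, ϖ ^ (i : ℕ) * dworkSol ϖ q a i ^ q ^ (n - i)) →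
      ∑ i ∈ Finset.range (n + 1), ϖ ^ i * dworkSol ϖ q a i ^ q ^ (n - i) = a n := by
    intro n hn
    have := Classical.epsilon_spec hn
    rw [← dworkSol] at this
    rw [Finset.sum_range_succ, Nat.sub_self, pow_zero, pow_one, this,
      Fin.sum_univ_eq_sum_range (fun i => ϖ ^ i * dworkSol ϖ q a i ^ q ^ (n - i)) n]
    ring
  induction n with
  | zero => exact key 0 ⟨a 0, by simp⟩
  | succ n ih =>
    apply key
    rw [Fin.sum_univ_eq_sum_range (fun i => ϖ ^ i * dworkSol ϖ q a i ^ q ^ (n + 1 - i)) (n + 1)]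
    have h1 : ϖ ^ (n + 1) ∣ σ (a n) -
        ∑ i ∈ Finset.range (n + 1), ϖ ^ i * dworkSol ϖ q a i ^ q ^ (n + 1 - i) := by
      rw [← ih, map_sum, ← Finset.sum_sub_distrib]
      refine Finset.dvd_sum fun i hi => ?_
      have hi : i ≤ n := Nat.lt_succ_iff.1 (Finset.mem_range.1 hi)
      have h := dvd_pow_sub_pow hq (m := 0) (by simpa using hσ (dworkSol ϖ q a i)) (n - i)
      rw [map_mul, map_pow, map_pow, hσϖ, ← mul_sub, Nat.succ_sub hi, pow_succ' q, pow_mul]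
      refine dvd_trans ?_ (mul_dvd_mul_left (ϖ ^ i) h)
      rw [← pow_add]
      exact pow_dvd_pow _ (by omega)
    obtain ⟨c, hc⟩ := dvd_sub h1 (ha n)
    exact ⟨c, by rw [← hc]; ring⟩

theorem ghost_unique {ϖ : A} (hϖ : IsLeftRegular ϖ) (q : ℕ) (b c : ℕ → A)
    (h : ∀ n, ∑ i ∈ Finset.range (n + 1), ϖ ^ i * b i ^ q ^ (n - i) =
      ∑ i ∈ Finset.range (n + 1), ϖ ^ i * c i ^ q ^ (n - i)) : b = c := by
  funext n
  induction n using Nat.strong_induction_on with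
  | _ n ih =>
    have hn := h n
    rw [Finset.sum_range_succ, Finset.sum_range_succ,
      Finset.sum_congr rfl fun i hi => by rw [ih i (Finset.mem_range.1 hi)]] at hn
    simpa using (hϖ.pow n) (by simpa using hn)

end Dwork

section Uniformizer

variable (O : Type*) [CommRing O] [IsDomain O] [IsDiscreteValuationRing O]

/-- A uniformizing parameter of a discrete valuation ring. -/
abbrev Uniformizer := {π : O // Irreducible π}

/-- The cardinality `q` of the (finite) residue field. -/
noncomputable abbrev residueCard : ℕ := Nat.card (ResidueField O)

variable {O}

lemma Uniformizer.dvd_iff (π : Uniformizer O) (x : O) : π.1 ∣ x ↔ residue O x = 0 := by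
  rw [residue_eq_zero_iff, π.2.maximalIdeal_eq, Ideal.mem_span_singleton]

lemma Uniformizer.dvd_residueCard [Finite (ResidueField O)] (π : Uniformizer O) :
    π.1 ∣ (residueCard O : O) := by
  rw [π.dvd_iff, map_natCast]
  cases nonempty_fintype (ResidueField O)
  rw [residueCard, Nat.card_eq_fintype_card, Nat.cast_card_eq_zero]

lemma expand_card {k τ : Type*} [Field k] [Finite k] (f : MvPolynomial τ k) :
    expand (Nat.card k) f = f ^ Nat.card k := by
  cases nonempty_fintype k
  obtain ⟨p, hp, n, hpp, hn⟩ := FiniteField.card' k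
  have : Fact p.Prime := ⟨hpp⟩
  rw [Nat.card_eq_fintype_card]
  induction f using MvPolynomial.induction_on with
  | C a => rw [expand_C, ← C_pow, FiniteField.pow_card]
  | add f g hf hg => rw [map_add, hf, hg, hn, add_pow_char_pow]
  | mul_X f i hf => rw [map_mul, hf, expand_X, mul_pow]

lemma Uniformizer.dvd_expand_sub_pow [Finite (ResidueField O)] (π : Uniformizer O) {τ : Type*}
    (f : MvPolynomial τ O) : C π.1 ∣ expand (residueCard O) f - f ^ residueCard O := by
  rw [C_dvd_iff_map_hom_eq_zero (residue O) _ fun r => (π.dvd_iff r).symm, map_sub, map_expand,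
    expand_card, map_pow, sub_self]

/-- The Witt polynomial `Φ_n = ∑_{i ≤ n} π ^ i X_i ^ (q ^ (n - i))`. -/
noncomputable def wittPhi (π : Uniformizer O) (n : ℕ) : MvPolynomial ℕ O :=
  ∑ i ∈ Finset.range (n + 1), C (π.1 ^ i) * X i ^ residueCard O ^ (n - i)

lemma aeval_wittPhi {B : Type*} [CommRing B] [Algebra O B] (π : Uniformizer O) (b : ℕ → B) (n : ℕ) :
    aeval b (wittPhi π n) = ∑ i ∈ Finset.range (n + 1),
      algebraMap O B π.1 ^ i * b i ^ residueCard O ^ (n - i) := by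
  simp [wittPhi, map_sum]

lemma ghost_injective {B : Type*} [CommRing B] [Algebra O B] (π : Uniformizer O)
    (hπ : IsLeftRegular (algebraMap O B π.1)) {b c : ℕ → B}
    (h : ∀ n, aeval b (wittPhi π n) = aeval c (wittPhi π n)) : b = c :=
  ghost_unique hπ (residueCard O) b c fun n => by simpa only [aeval_wittPhi] using h n

variable [Finite (ResidueField O)]

theorem exists_ghost (π : Uniformizer O) {τ : Type*} (a : ℕ → MvPolynomial τ O)
    (ha : ∀ n, C π.1 ^ (n + 1) ∣ expand (residueCard O) (a n) - a (n + 1)) (n : ℕ) :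
    aeval (dworkSol (C π.1) (residueCard O) a) (wittPhi π n) = a n := by
  rw [aeval_wittPhi, algebraMap_eq]
  exact dworkSol_spec (C π.1) (residueCard O)
    (by simpa using map_dvd (C (σ := τ)) π.dvd_residueCard)
    (expand (residueCard O)).toRingHom (by simp) (fun x => π.dvd_expand_sub_pow x) a ha n

lemma wittPhi_succ_dvd (π : Uniformizer O) (n : ℕ) :
    C π.1 ^ (n + 1) ∣ expand (residueCard O) (wittPhi π n) - wittPhi π (n + 1) := by
  refine ⟨- X (n + 1), ?_⟩
  rw [wittPhi, wittPhi, Finset.sum_range_succ (n := n + 1), map_sum, ← sub_sub,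
    ← Finset.sum_sub_distrib, Finset.sum_eq_zero]
  · simp
  intro i hi
  have hi : i ≤ n := Nat.lt_succ_iff.1 (Finset.mem_range.1 hi)
  rw [map_mul, map_pow _ (X i), expand_X, expand_C, Nat.succ_sub hi, pow_succ' (residueCard O), pow_mul, sub_self]

/-- The polynomials giving the Witt components of the operation on ramified Witt vectors which is
given on ghost components by the polynomial `f`: they are characterised by `aeval_opPoly`. -/
noncomputable def opPoly (π : Uniformizer O) {ι : Type*} (f : MvPolynomial ι O) :
    ℕ → MvPolynomial (ι × ℕ) O :=
  dworkSol (C π.1) (residueCard O)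
    fun n => bind₁ (fun i => rename (Prod.mk i) (wittPhi π n)) f

lemma aeval_opPoly (π : Uniformizer O) {ι : Type*} (f : MvPolynomial ι O) (n : ℕ) :
    aeval (opPoly π f) (wittPhi π n) = bind₁ (fun i => rename (Prod.mk i) (wittPhi π n)) f := by
  refine exists_ghost π _ (fun n => ?_) n
  have h : ∀ (S : Ideal (MvPolynomial (ι × ℕ) O)) (u v : ι → MvPolynomial (ι × ℕ) O),
      (∀ i, u i - v i ∈ S) → bind₁ u f - bind₁ v f ∈ S := by
    intro S u v h
    rw [← Ideal.Quotient.mk_eq_mk_iff_sub_mem]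
    rw [← Ideal.Quotient.mkₐ_eq_mk O, ← AlgHom.comp_apply, ← AlgHom.comp_apply]
    congr 1
    ext i
    simpa [Ideal.Quotient.mk_eq_mk_iff_sub_mem] using h i
  rw [← Ideal.mem_span_singleton]
  rw [expand_bind₁]
  refine h _ _ _ fun i => ?_
  rw [Ideal.mem_span_singleton, ← rename_expand, ← map_sub]
  simpa using map_dvd (rename (R := O) (Prod.mk i)) (wittPhi_succ_dvd π n)

end Uniformizer

section Extension

open scoped TensorProduct

variable {O O' : Type*} [CommRing O] [IsDomain O] [IsDiscreteValuationRing O]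
  [CommRing O'] [IsDomain O'] [IsDiscreteValuationRing O']
  [Algebra O O'] [IsLocalHom (algebraMap O O')]

variable (O O') in
/-- The residue degree `r` of `O' / O`. -/
noncomputable abbrev residueDegree : ℕ := Module.finrank (ResidueField O) (ResidueField O')

variable (O O') in
/-- A finite extension of discrete valuation rings is totally ramified if the extension of residue
fields is trivial. -/
def IsTotallyRamified : Prop :=
  Function.Bijective (algebraMap (ResidueField O) (ResidueField O'))

theorem IsTotallyRamified.top_le_span [Module.Finite O O'] [FaithfulSMul O O']
    (h : IsTotallyRamified O O') {ϖ : O'} (hϖ : Irreducible ϖ) {e : ℕ}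
    (he : Module.finrank O O' = e) :
    ⊤ ≤ Submodule.span O (Set.range fun i : Fin e => ϖ ^ (i : ℕ)) := by
  have hm : (maximalIdeal O).map (algebraMap O O') ≠ ⊥ := by
    rw [Ne, Ideal.map_eq_bot_iff_of_injective (FaithfulSMul.algebraMap_injective O O')]
    exact IsDiscreteValuationRing.not_a_field O
  have : Module.IsTorsionFree O O' := inferInstance
  have : Fintype ((maximalIdeal O).primesOver O') := by
    have : Finite ((maximalIdeal O).primesOver O') := inferInstance
    exact Fintype.ofFinite _
  have hle : (maximalIdeal O').ramificationIdx O ≤ e := by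
    rw [← he, ← Ideal.sum_ramification_inertia_eq_finrank (maximalIdeal O) O']
    refine le_trans (Nat.le_mul_of_pos_right _ (Ideal.inertiaDeg_pos (maximalIdeal O') O))
      (Finset.single_le_sum (f := fun q : (maximalIdeal O).primesOver O' =>
        q.1.ramificationIdx O * q.1.inertiaDeg O) (fun _ _ => Nat.zero_le _)
        (Finset.mem_univ ⟨maximalIdeal O', inferInstance, inferInstance⟩))
  obtain ⟨m, hm'⟩ := IsDiscreteValuationRing.ideal_eq_span_pow_irreducible hm hϖ
  have hme : m ≤ e := by
    refine le_trans (le_of_eq ?_) hle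
    rw [Ideal.IsDedekindDomain.ramificationIdx_eq_multiplicity (maximalIdeal O) _ hm, hm', ← Ideal.span_singleton_pow, ← hϖ.maximalIdeal_eq]
    symm
    refine multiplicity_pow_self ?_ ?_ _
    · exact IsDiscreteValuationRing.not_a_field O'
    · exact fun hu => (maximalIdeal.isMaximal O').ne_top (Ideal.isUnit_iff.1 hu)
  have key : ∀ j, ∀ x : O', ∃ y ∈ Submodule.span O (Set.range fun i : Fin j => ϖ ^ (i : ℕ)),
      ϖ ^ j ∣ x - y := by
    intro j
    induction j with
    | zero => exact fun x => ⟨0, zero_mem _, by simp⟩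
    | succ j ih =>
      intro x
      obtain ⟨y, hy, c, hc⟩ := ih x
      obtain ⟨a, ha⟩ := h.2 (residue O' c)
      obtain ⟨a, rfl⟩ := residue_surjective a
      rw [ResidueField.algebraMap_residue, eq_comm, ← sub_eq_zero, ← map_sub, residue_eq_zero_iff,
        hϖ.maximalIdeal_eq, Ideal.mem_span_singleton] at ha
      obtain ⟨d, hd⟩ := ha
      refine ⟨y + a • ϖ ^ j, add_mem (Submodule.span_mono ?_ hy)
        (Submodule.smul_mem _ _ (Submodule.subset_span ⟨Fin.last j, by simp⟩)), d, ?_⟩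
      · rintro _ ⟨i, rfl⟩
        exact ⟨i.castSucc, rfl⟩
      · rw [← sub_sub, hc, Algebra.smul_def, pow_succ, mul_assoc, ← hd]
        ring
  refine Submodule.le_of_le_smul_of_le_jacobson_bot (I := maximalIdeal O) Module.Finite.fg_top
    (maximalIdeal_le_jacobson _) fun x _ => ?_
  obtain ⟨y, hy, hxy⟩ := key e x
  rw [← sub_add_cancel x y, add_comm]
  refine Submodule.add_mem_sup hy ?_
  rw [Ideal.smul_top_eq_map, Submodule.restrictScalars_mem, hm', Ideal.mem_span_singleton]
  exact (pow_dvd_pow ϖ hme).trans hxy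

/-- The basis `1, ϖ, …, ϖ ^ (e - 1)` of `O'` over `O`. -/
noncomputable def IsTotallyRamified.basis [Module.Finite O O'] [FaithfulSMul O O']
    (h : IsTotallyRamified O O') {ϖ : O'} (hϖ : Irreducible ϖ) {e : ℕ}
    (he : Module.finrank O O' = e) : Module.Basis (Fin e) O O' :=
  basisOfTopLeSpanOfCardEqFinrank (fun i : Fin e => ϖ ^ (i : ℕ)) (h.top_le_span hϖ he) (by simp [he])

theorem IsTotallyRamified.sum_tmul_bijective [Module.Finite O O'] [FaithfulSMul O O']
    (h : IsTotallyRamified O O') {ϖ : O'} (hϖ : Irreducible ϖ) {e : ℕ}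
    (he : Module.finrank O O' = e) (M : Type*) [AddCommGroup M] [Module O M] :
    Function.Bijective fun b : Fin e → M => ∑ i, b i ⊗ₜ[O] (ϖ ^ (i : ℕ)) := by
  convert (Finsupp.equivFunOnFinite.symm.trans
    (TensorProduct.equivFinsuppOfBasisRight (M := M) (h.basis hϖ he)).symm.toEquiv).bijective using 1
  funext b
  simp [IsTotallyRamified.basis, Finsupp.sum_fintype]

end Extension

end RamWitt

/-- The ramified Witt vectors `W_O(B)` with components in the `O`-algebra `B`, relative to the
uniformizer `π` of `O`. As a set this is `B ^ ℕ`; the `O`-algebra structure is the functorial one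
for which the ghost components `Φ_n` are homomorphisms of `O`-algebras (see `ghostHom`, `map`). -/
@[ext]
structure RamifiedWitt {O : Type*} [CommRing O] [IsDomain O] [IsDiscreteValuationRing O]
    (π : RamWitt.Uniformizer O) (B : Type*) where
  /-- The components `b_0, b_1, …`. -/
  coeff : ℕ → B

namespace RamifiedWitt

open RamWitt MvPolynomial IsLocalRing

variable {O : Type*} [CommRing O] [IsDomain O] [IsDiscreteValuationRing O]
  {π : Uniformizer O} {A B : Type*} [CommRing A] [CommRing B] [Algebra O A] [Algebra O B]
  {ι κ : Type*}

/-- The ghost component `Φ_n(b)`. -/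
noncomputable def ghost (n : ℕ) (b : RamifiedWitt π B) : B := aeval b.coeff (wittPhi π n)

lemma ghost_ext (hπ : IsLeftRegular (algebraMap O B π.1)) {b c : RamifiedWitt π B}
    (h : ∀ n, b.ghost n = c.ghost n) : b = c :=
  RamifiedWitt.ext (ghost_injective π hπ h)

/-- The map on ramified Witt vectors induced by a homomorphism of `O`-algebras. -/
def mapFun (φ : A → B) (b : RamifiedWitt π A) : RamifiedWitt π B := ⟨fun n => φ (b.coeff n)⟩

/-- The universal family of ramified Witt vectors indexed by `ι`. -/
noncomputable def univ (π : Uniformizer O) (R : Type*) [CommRing R] (ι : Type*) (i : ι) :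
    RamifiedWitt π (MvPolynomial (ι × ℕ) R) := ⟨fun n => X (i, n)⟩

lemma mapFun_univ {R : Type*} [CommRing R] [Algebra R B] (v : ι → RamifiedWitt π B) (i : ι) :
    mapFun (aeval fun p : ι × ℕ => (v p.1).coeff p.2) (univ π R ι i) = v i := by
  ext n; simp [mapFun, univ]

variable [Finite (ResidueField O)]

/-- The operation on ramified Witt vectors given on ghost components by the polynomial `f`
(see `ghost_op`). -/
noncomputable def polyOp (f : MvPolynomial ι O) (v : ι → RamifiedWitt π B) : RamifiedWitt π B :=
  ⟨fun n => aeval (fun p : ι × ℕ => (v p.1).coeff p.2) (opPoly π f n)⟩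

lemma ghost_op (f : MvPolynomial ι O) (v : ι → RamifiedWitt π B) (n : ℕ) :
    (polyOp f v).ghost n = aeval (fun i => (v i).ghost n) f := by
  have h := congrArg (aeval fun p : ι × ℕ => (v p.1).coeff p.2) (aeval_opPoly π f n)
  rw [comp_aeval_apply, aeval_bind₁] at h
  simpa [ghost, polyOp, aeval_rename, Function.comp_def] using h

lemma map_op (φ : A →ₐ[O] B) (f : MvPolynomial ι O) (v : ι → RamifiedWitt π A) :
    mapFun φ (polyOp f v) = polyOp f fun i => mapFun φ (v i) := by
  ext n
  simp [mapFun, polyOp, comp_aeval_apply]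

lemma isLeftRegular_algebraMap {τ R : Type*} [CommRing R] [IsDomain R] [Algebra O R]
    [FaithfulSMul O R] : IsLeftRegular (algebraMap O (MvPolynomial τ R) π.1) := by
  refine IsLeftCancelMulZero.mul_left_cancel_of_ne_zero ?_
  rw [MvPolynomial.algebraMap_apply, Ne, C_eq_zero,
    FaithfulSMul.algebraMap_eq_zero_iff]
  exact π.2.ne_zero

lemma op_op (f : MvPolynomial ι O) (g : ι → MvPolynomial κ O) (v : κ → RamifiedWitt π B) :
    polyOp f (fun i => polyOp (g i) v) = polyOp (bind₁ g f) v := by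
  have h : polyOp f (fun i => polyOp (g i) (univ π O κ)) = polyOp (bind₁ g f) (univ π O κ) :=
    ghost_ext isLeftRegular_algebraMap fun n => by
      simp only [ghost_op, aeval_bind₁]
  have := congrArg (mapFun (aeval fun p : κ × ℕ => (v p.1).coeff p.2)) h
  simpa only [map_op, mapFun_univ] using this

lemma op_X (i : ι) (v : ι → RamifiedWitt π B) : polyOp (X i) v = v i := by
  have h : polyOp (X i) (univ π O ι) = univ π O ι i :=
    ghost_ext isLeftRegular_algebraMap fun n => by simp only [ghost_op, aeval_X]
  have := congrArg (mapFun (aeval fun p : ι × ℕ => (v p.1).coeff p.2)) h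
  simpa only [map_op, mapFun_univ] using this

noncomputable instance : Add (RamifiedWitt π B) := ⟨fun a b => polyOp (X 0 + X 1) ![a, b]⟩
noncomputable instance : Mul (RamifiedWitt π B) := ⟨fun a b => polyOp (X 0 * X 1) ![a, b]⟩
noncomputable instance : Neg (RamifiedWitt π B) := ⟨fun a => polyOp (-X 0) ![a]⟩
noncomputable instance : Zero (RamifiedWitt π B) := ⟨polyOp 0 ![]⟩
noncomputable instance : One (RamifiedWitt π B) := ⟨polyOp 1 ![]⟩

lemma op_add (f g : MvPolynomial ι O) (v : ι → RamifiedWitt π B) :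
    polyOp (f + g) v = polyOp f v + polyOp g v := by
  have h := op_op (X 0 + X 1) ![f, g] v
  rw [map_add, bind₁_X_right, bind₁_X_right] at h
  refine h.symm.trans (congrArg (polyOp (X 0 + X 1)) ?_)
  funext i; fin_cases i <;> rfl

lemma op_mul (f g : MvPolynomial ι O) (v : ι → RamifiedWitt π B) :
    polyOp (f * g) v = polyOp f v * polyOp g v := by
  have h := op_op (X 0 * X 1) ![f, g] v
  rw [map_mul, bind₁_X_right, bind₁_X_right] at h
  refine h.symm.trans (congrArg (polyOp (X 0 * X 1)) ?_)
  funext i; fin_cases i <;> rfl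

lemma op_neg (f : MvPolynomial ι O) (v : ι → RamifiedWitt π B) : polyOp (-f) v = -polyOp f v := by
  have h := op_op (-X 0) ![f] v
  rw [map_neg, bind₁_X_right] at h
  refine h.symm.trans (congrArg (polyOp (-X 0)) ?_)
  funext i; fin_cases i; rfl

lemma op_C (r : O) (v : ι → RamifiedWitt π B) : polyOp (C r) v = polyOp (C r) ![] := by
  have h := op_op (C r : MvPolynomial (Fin 0) O) ![] v
  rw [bind₁_C_right] at h
  exact h.symm.trans (congrArg _ (Subsingleton.elim _ _))

lemma op_zero (v : ι → RamifiedWitt π B) : polyOp 0 v = 0 := by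
  rw [← C_0, op_C, C_0]; rfl

lemma op_one (v : ι → RamifiedWitt π B) : polyOp 1 v = 1 := by
  rw [← C_1, op_C, C_1]; rfl

lemma exists_op (x y z : RamifiedWitt π B) : ∃ (v : Fin 3 → RamifiedWitt π B)
    (f g h : MvPolynomial (Fin 3) O), x = polyOp f v ∧ y = polyOp g v ∧ z = polyOp h v :=
  ⟨![x, y, z], X 0, X 1, X 2, (op_X 0 ![x, y, z]).symm, (op_X 1 ![x, y, z]).symm,
    (op_X 2 ![x, y, z]).symm⟩

noncomputable instance : CommRing (RamifiedWitt π B) where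
  add_assoc x y z := by
    obtain ⟨v, f, g, h, rfl, rfl, rfl⟩ := exists_op x y z
    simp only [← op_add, add_assoc]
  zero_add x := by
    obtain ⟨v, f, g, h, rfl, -, -⟩ := exists_op x x x
    rw [← op_zero v, ← op_add, zero_add]
  add_zero x := by
    obtain ⟨v, f, g, h, rfl, -, -⟩ := exists_op x x x
    rw [← op_zero v, ← op_add, add_zero]
  add_comm x y := by
    obtain ⟨v, f, g, h, rfl, rfl, -⟩ := exists_op x y y
    rw [← op_add, ← op_add, add_comm]
  nsmul := nsmulRec
  zsmul := zsmulRec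
  neg_add_cancel x := by
    obtain ⟨v, f, g, h, rfl, -, -⟩ := exists_op x x x
    rw [← op_neg, ← op_add, neg_add_cancel, op_zero]
  mul_assoc x y z := by
    obtain ⟨v, f, g, h, rfl, rfl, rfl⟩ := exists_op x y z
    simp only [← op_mul, mul_assoc]
  one_mul x := by
    obtain ⟨v, f, g, h, rfl, -, -⟩ := exists_op x x x
    rw [← op_one v, ← op_mul, one_mul]
  mul_one x := by
    obtain ⟨v, f, g, h, rfl, -, -⟩ := exists_op x x x
    rw [← op_one v, ← op_mul, mul_one]
  mul_comm x y := by
    obtain ⟨v, f, g, h, rfl, rfl, -⟩ := exists_op x y y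
    rw [← op_mul, ← op_mul, mul_comm]
  left_distrib x y z := by
    obtain ⟨v, f, g, h, rfl, rfl, rfl⟩ := exists_op x y z
    simp only [← op_mul, ← op_add, mul_add]
  right_distrib x y z := by
    obtain ⟨v, f, g, h, rfl, rfl, rfl⟩ := exists_op x y z
    simp only [← op_mul, ← op_add, add_mul]
  zero_mul x := by
    obtain ⟨v, f, g, h, rfl, -, -⟩ := exists_op x x x
    rw [← op_zero v, ← op_mul, zero_mul]
  mul_zero x := by
    obtain ⟨v, f, g, h, rfl, -, -⟩ := exists_op x x x
    rw [← op_zero v, ← op_mul, mul_zero]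

noncomputable instance : Algebra O (RamifiedWitt π B) :=
  RingHom.toAlgebra
    { toFun := fun r => polyOp (C r) ![]
      map_one' := by rw [C_1]; rfl
      map_mul' := fun r s => by rw [C_mul, op_mul]
      map_zero' := by rw [C_0]; rfl
      map_add' := fun r s => by rw [C_add, op_add] }

lemma algebraMap_eq_op (r : O) : algebraMap O (RamifiedWitt π B) r = polyOp (C r) ![] := rfl

/-- The ghost map `b ↦ (Φ_0(b), Φ_1(b), …)` is a homomorphism of `O`-algebras. -/
noncomputable def ghostHom : RamifiedWitt π B →ₐ[O] (ℕ → B) where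
  toFun b n := b.ghost n
  map_one' := by funext n; exact (ghost_op 1 ![] n).trans (by simp)
  map_mul' a b := by funext n; exact (ghost_op (X 0 * X 1) ![a, b] n).trans (by simp)
  map_zero' := by funext n; exact (ghost_op 0 ![] n).trans (by simp)
  map_add' a b := by funext n; exact (ghost_op (X 0 + X 1) ![a, b] n).trans (by simp)
  commutes' r := by funext n; exact (ghost_op (C r) ![] n).trans (by simp)

/-- Functoriality of the ramified Witt vectors. -/
noncomputable def map (φ : A →ₐ[O] B) : RamifiedWitt π A →ₐ[O] RamifiedWitt π B where
  toFun := mapFun φ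
  map_one' := (map_op φ 1 ![]).trans (congrArg _ (Subsingleton.elim _ _))
  map_mul' a b := (map_op φ (X 0 * X 1) ![a, b]).trans
    (congrArg (polyOp (X 0 * X 1)) (by funext i; fin_cases i <;> rfl))
  map_zero' := (map_op φ 0 ![]).trans (congrArg _ (Subsingleton.elim _ _))
  map_add' a b := (map_op φ (X 0 + X 1) ![a, b]).trans
    (congrArg (polyOp (X 0 + X 1)) (by funext i; fin_cases i <;> rfl))
  commutes' r := (map_op φ (C r) ![]).trans (congrArg _ (Subsingleton.elim _ _))

section Drinfeld

variable {O' : Type*} [CommRing O'] [IsDomain O'] [IsDiscreteValuationRing O']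
  [Algebra O O'] [IsLocalHom (algebraMap O O')] [Finite (ResidueField O')]

/-- The polynomials `u_n` over `O'` with `Φ'_n(u_0, u_1, …) = Φ_{r n}`, where `r` is the residue
degree of `O' / O` (see `aeval_drinfeldPoly`). -/
noncomputable def drinfeldPoly (π : Uniformizer O) (ϖ : Uniformizer O') : ℕ → MvPolynomial ℕ O' :=
  dworkSol (C ϖ.1) (residueCard O')
    fun n => MvPolynomial.map (algebraMap O O') (wittPhi π (residueDegree O O' * n))

lemma aeval_drinfeldPoly (π : Uniformizer O) (ϖ : Uniformizer O') (n : ℕ) :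
    aeval (drinfeldPoly π ϖ) (wittPhi ϖ n) =
      MvPolynomial.map (algebraMap O O') (wittPhi π (residueDegree O O' * n)) := by
  refine exists_ghost ϖ _ (fun n => ?_) n
  have hr : 0 < residueDegree O O' := by
    have : Module.Finite (ResidueField O) (ResidueField O') := Module.Finite.of_finite
    exact Module.finrank_pos
  have hq : residueCard O' = residueCard O ^ residueDegree O O' :=
    Module.natCard_eq_pow_finrank
  have hπ : ϖ.1 ∣ algebraMap O O' π.1 := by
    rw [ϖ.dvd_iff, ← ResidueField.algebraMap_residue, (π.dvd_iff π.1).1 dvd_rfl, map_zero]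
  have hn : n ≤ residueDegree O O' * n := Nat.le_mul_of_pos_left n hr
  rw [← map_expand, ← map_sub, hq]
  have hC : ∀ m, n + 1 ≤ m → C ϖ.1 ^ (n + 1) ∣
      (C (algebraMap O O' π.1) ^ m : MvPolynomial ℕ O') := fun m hm =>
    (pow_dvd_pow _ hm).trans (pow_dvd_pow_of_dvd (map_dvd C hπ) m)
  have key : ∀ s, C π.1 ^ (residueDegree O O' * n + 1) ∣
      expand (residueCard O ^ s) (wittPhi π (residueDegree O O' * n)) -
        wittPhi π (residueDegree O O' * n + s) := by
    intro s
    induction s with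
    | zero => simp
    | succ s ih =>
      have h1 := (pow_dvd_pow (C (σ := ℕ) π.1) (show residueDegree O O' * n + 1 ≤
        residueDegree O O' * n + s + 1 by omega)).trans
          (wittPhi_succ_dvd π (residueDegree O O' * n + s))
      have h2 := map_dvd (expand (residueCard O)) ih
      rw [map_pow, expand_C, map_sub, ← expand_mul, ← pow_succ'] at h2
      have := dvd_add h2 h1
      rwa [sub_add_sub_cancel] at this
  have h := map_dvd (MvPolynomial.map (σ := ℕ) (algebraMap O O')) (key (residueDegree O O'))
  rw [map_pow, map_C] at h
  rw [mul_add_one]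
  exact (hC _ (by omega)).trans h

variable {B : Type*} [CommRing B] [Algebra O B] [Algebra O' B] [IsScalarTower O O' B]
  {π : Uniformizer O} (ϖ : Uniformizer O')

/-- The map underlying Drinfeld's homomorphism; it satisfies `Φ'_n(u(b)) = Φ_{r n}(b)`, see
`ghost_drinfeldFun`. -/
noncomputable def drinfeldFun (b : RamifiedWitt π B) : RamifiedWitt ϖ B :=
  ⟨fun n => aeval b.coeff (drinfeldPoly π ϖ n)⟩

lemma ghost_drinfeldFun (b : RamifiedWitt π B) (n : ℕ) :
    (drinfeldFun ϖ b).ghost n = b.ghost (residueDegree O O' * n) := by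
  have h := congrArg (aeval b.coeff) (aeval_drinfeldPoly π ϖ n)
  rw [comp_aeval_apply, aeval_map_algebraMap] at h
  exact h

lemma drinfeldFun_map {A : Type*} [CommRing A] [Algebra O A] [Algebra O' A]
    (φ : A →ₐ[O'] B) (b : RamifiedWitt π A) :
    drinfeldFun ϖ (mapFun φ b) = mapFun φ (drinfeldFun ϖ b) := by
  ext n
  simp [drinfeldFun, mapFun, comp_aeval_apply]

lemma drinfeldFun_op (f : MvPolynomial ι O) (v : ι → RamifiedWitt π B) :
    drinfeldFun ϖ (polyOp f v) =
      polyOp (MvPolynomial.map (algebraMap O O') f) fun i => drinfeldFun ϖ (v i) := by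
  have h : drinfeldFun ϖ (polyOp f (univ π O' ι)) =
      polyOp (MvPolynomial.map (algebraMap O O') f) fun i => drinfeldFun ϖ (univ π O' ι i) :=
    ghost_ext isLeftRegular_algebraMap fun n => by
      simp only [ghost_drinfeldFun, ghost_op, aeval_map_algebraMap]
  have := congrArg (mapFun (aeval (R := O') fun p : ι × ℕ => (v p.1).coeff p.2)) h
  have h2 := map_op (AlgHom.restrictScalars O (aeval (R := O') fun p : ι × ℕ => (v p.1).coeff p.2))
    f (univ π O' ι)
  simp only [AlgHom.coe_restrictScalars'] at h2
  simpa only [map_op, mapFun_univ, ← drinfeldFun_map, h2] using this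

/-- Drinfeld's homomorphism `u : W_O(B) → W_{O'}(B)`, functorial in the `O'`-algebra `B`. -/
noncomputable def drinfeld : RamifiedWitt π B →+* RamifiedWitt ϖ B where
  toFun := drinfeldFun ϖ
  map_one' := (drinfeldFun_op ϖ 1 ![]).trans <| by rw [map_one]; exact op_one _
  map_mul' a b := (drinfeldFun_op ϖ (X 0 * X 1) ![a, b]).trans <| by
    rw [map_mul, op_mul, map_X, map_X, op_X, op_X]; rfl
  map_zero' := (drinfeldFun_op ϖ 0 ![]).trans <| by rw [map_zero]; exact op_zero _
  map_add' a b := (drinfeldFun_op ϖ (X 0 + X 1) ![a, b]).trans <| by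
    rw [map_add, op_add, map_X, map_X, op_X, op_X]; rfl

lemma drinfeld_algebraMap (r : O) :
    drinfeld ϖ (algebraMap O (RamifiedWitt π B) r) =
      algebraMap O' (RamifiedWitt ϖ B) (algebraMap O O' r) :=
  (drinfeldFun_op ϖ (C r) ![]).trans <| by rw [map_C, op_C]; rfl

lemma drinfeld_map {A : Type*} [CommRing A] [Algebra O A] [Algebra O' A] [IsScalarTower O O' A]
    (φ : A →ₐ[O'] B) (b : RamifiedWitt π A) :
    drinfeld ϖ (map (φ.restrictScalars O) b) = map φ (drinfeld ϖ b) :=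
  drinfeldFun_map ϖ φ b

open scoped TensorProduct

/-- The homomorphism `W_O(B) ⊗_O O' → W_{O'}(B)`, `b ⊗ x ↦ u(b) x`, extending Drinfeld's
homomorphism (see `drinfeldTensor_tmul`). -/
noncomputable def drinfeldTensor (π : Uniformizer O) (ϖ : Uniformizer O') (B : Type*) [CommRing B]
    [Algebra O B] [Algebra O' B] [IsScalarTower O O' B] :
    RamifiedWitt π B ⊗[O] O' →+* RamifiedWitt ϖ B :=
  letI : Algebra O (RamifiedWitt ϖ B) :=
    ((algebraMap O' (RamifiedWitt ϖ B)).comp (algebraMap O O')).toAlgebra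
  (Algebra.TensorProduct.lift (S := O)
    ({ drinfeld ϖ with commutes' := drinfeld_algebraMap ϖ } : RamifiedWitt π B →ₐ[O] RamifiedWitt ϖ B)
    ({ algebraMap O' (RamifiedWitt ϖ B) with commutes' := fun _ => rfl } :
      O' →ₐ[O] RamifiedWitt ϖ B) (fun _ _ => Commute.all _ _)).toRingHom

lemma drinfeldTensor_tmul (b : RamifiedWitt π B) (x : O') :
    drinfeldTensor π ϖ B (b ⊗ₜ x) = drinfeld ϖ b * algebraMap O' (RamifiedWitt ϖ B) x := by
  letI : Algebra O (RamifiedWitt ϖ B) :=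
    ((algebraMap O' (RamifiedWitt ϖ B)).comp (algebraMap O O')).toAlgebra
  exact Algebra.TensorProduct.lift_tmul _ _ _ _ _

lemma drinfeldTensor_map {A : Type*} [CommRing A] [Algebra O A] [Algebra O' A] [IsScalarTower O O' A]
    (φ : A →ₐ[O'] B) (x : RamifiedWitt π A ⊗[O] O') :
    drinfeldTensor π ϖ B (Algebra.TensorProduct.map (map (φ.restrictScalars O)) (AlgHom.id O O') x) =
      map φ (drinfeldTensor π ϖ A x) := by
  induction x with
  | zero => simp
  | add x y hx hy => simp only [map_add, hx, hy]
  | tmul b x => simp only [Algebra.TensorProduct.map_tmul, drinfeldTensor_tmul, drinfeld_map, map_mul,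
      AlgHom.commutes, AlgHom.id_apply]

end Drinfeld

end RamifiedWitt

namespace RamWitt

section Schemes

open MvPolynomial IsLocalRing CategoryTheory Opposite
open scoped TensorProduct

universe w v u

/-- Restriction of scalars for commutative algebras. -/
noncomputable def restrictAlg (R : Type u) (S : Type v) [CommRing R] [CommRing S] [Algebra R S] :
    CommAlgCat.{w} S ⥤ CommAlgCat.{w} R where
  obj B := letI := Algebra.compHom B (algebraMap R S); CommAlgCat.of R B
  map {A B} φ :=
    letI := Algebra.compHom A (algebraMap R S)
    letI := Algebra.compHom B (algebraMap R S)
    CommAlgCat.ofHom { φ.hom with commutes' := fun r => φ.hom.commutes (algebraMap R S r) }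

/-- The underlying additive group of a commutative ring, written multiplicatively. -/
def addGroupFunctor : CommRingCat.{v} ⥤ GrpCat.{v} where
  obj R := GrpCat.of (Multiplicative R)
  map φ := GrpCat.ofHom (AddMonoidHom.toMultiplicative φ.hom.toAddMonoidHom)

section Representable

variable {R : Type v} [CommRing R]

/-- Coordinates, indexed by `σ`, on a ring valued functor on `R`-algebras: a natural bijection of
`F(B)` with `B ^ σ`. -/
structure Coordinates (F : CommAlgCat.{v} R ⥤ CommRingCat.{v}) (σ : Type) where
  /-- The coordinates of an element of `F(B)`. -/
  equiv (B : CommAlgCat.{v} R) : F.obj B ≃ (σ → B)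
  naturality {B C : CommAlgCat.{v} R} (φ : B ⟶ C) (x : F.obj B) (i : σ) :
    equiv C (F.map φ x) i = φ.hom (equiv B x i)

namespace Coordinates

variable {F G : CommAlgCat.{v} R ⥤ CommRingCat.{v}} {σ τ : Type}

/-- The additive group of `F` as a presheaf on affine `R`-schemes. -/
def presheaf (F : CommAlgCat.{v} R ⥤ CommRingCat.{v}) : (CommAlgCat.{v} R)ᵒᵖᵒᵖ ⥤ GrpCat.{v} :=
  unopUnop _ ⋙ F ⋙ addGroupFunctor

/-- A ring valued functor with coordinates indexed by `σ` is represented by the polynomial ring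
`R[X_s; s ∈ σ]`. -/
noncomputable def representableBy (c : Coordinates F σ) :
    (presheaf F ⋙ forget _).RepresentableBy (op (CommAlgCat.of R (MvPolynomial σ R))) where
  homEquiv {X} :=
    { toFun := fun f => Multiplicative.ofAdd ((c.equiv X.unop).symm fun i => f.unop.hom (MvPolynomial.X i))
      invFun := fun x => (CommAlgCat.ofHom (aeval (c.equiv X.unop (Multiplicative.toAdd x)))).op
      left_inv := fun f => by
        apply Quiver.Hom.unop_inj
        ext i
        change aeval (c.equiv X.unop ((c.equiv X.unop).symm _)) (MvPolynomial.X i) = _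
        rw [Equiv.apply_symm_apply, aeval_X]
      right_inv := fun x => by
        change (c.equiv X.unop).symm (fun i => aeval _ (MvPolynomial.X i)) = Multiplicative.toAdd x
        simp only [aeval_X]
        exact (c.equiv X.unop).symm_apply_apply _ }
  homEquiv_comp {X Y} f g := by
    apply (c.equiv X.unop).injective
    funext i
    change c.equiv X.unop ((c.equiv X.unop).symm _) i =
      c.equiv X.unop (F.map f.unop ((c.equiv Y.unop).symm _)) i
    rw [c.naturality, Equiv.apply_symm_apply, Equiv.apply_symm_apply]
    rfl

/-- The spectrum of `R[X_s; s ∈ σ]`, with the additive group structure of the functor `F` which it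
represents. -/
noncomputable def groupObj (c : Coordinates F σ) : Grp (CommAlgCat.{v} R)ᵒᵖ :=
  letI := GrpObj.ofRepresentableBy _ (presheaf F) c.representableBy
  ⟨op (CommAlgCat.of R (MvPolynomial σ R))⟩

/-- The homomorphism of affine group schemes that induces a given natural transformation of ring
valued functors. -/
noncomputable def groupHom (c : Coordinates F σ) (d : Coordinates G τ) (α : F ⟶ G) :
    c.groupObj ⟶ d.groupObj :=
  yonedaGrpFullyFaithful.preimage
    ((yonedaGrpObjIsoOfRepresentableBy _ (presheaf F) c.representableBy).hom ≫
      (Functor.whiskerLeft (unopUnop _) (Functor.whiskerRight α addGroupFunctor)) ≫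
      (yonedaGrpObjIsoOfRepresentableBy _ (presheaf G) d.representableBy).inv)

end Coordinates

end Representable

section Functors

variable {O : Type u} [CommRing O] [IsDomain O] [IsDiscreteValuationRing O]
  [Finite (ResidueField O)]

/-- The functor `B ↦ W_O(B)` on `O`-algebras. -/
noncomputable def wittFunctor (π : Uniformizer O) : CommAlgCat.{w} O ⥤ CommRingCat.{w} where
  obj B := CommRingCat.of (RamifiedWitt π B)
  map φ := CommRingCat.ofHom (RamifiedWitt.map φ.hom).toRingHom

/-- The coordinates of the Witt vector functor are the Witt components. -/
def wittCoordinates (π : Uniformizer O) (R : Type v) [CommRing R] [Algebra O R] :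
    Coordinates (restrictAlg O R ⋙ wittFunctor π) ℕ where
  equiv _ := ⟨RamifiedWitt.coeff, RamifiedWitt.mk, fun _ => rfl, fun _ => rfl⟩
  naturality _ _ _ := rfl

variable {O' : Type v} [CommRing O'] [IsDomain O'] [IsDiscreteValuationRing O']
  [Finite (ResidueField O')] [Algebra O O']

variable (O') in
/-- The functor `B ↦ W_O(B) ⊗_O O'` on `O'`-algebras. -/
noncomputable def wittTensorFunctor (π : Uniformizer O) : CommAlgCat.{v} O' ⥤ CommRingCat.{v} where
  obj B := CommRingCat.of (RamifiedWitt π ((restrictAlg O O').obj B) ⊗[O] O')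
  map φ := CommRingCat.ofHom (Algebra.TensorProduct.map
    (RamifiedWitt.map ((restrictAlg O O').map φ).hom) (AlgHom.id O O')).toRingHom
  map_id B := CommRingCat.hom_ext <| RingHom.ext fun x => by
    exact DFunLike.congr_fun (Algebra.TensorProduct.map_id (R := O) (S := O)
      (A := RamifiedWitt π ((restrictAlg O O').obj B)) (B := O')) x
  map_comp φ ψ := CommRingCat.hom_ext <| RingHom.ext fun x => by
    exact DFunLike.congr_fun (Algebra.TensorProduct.map_comp (R := O) (S := O)
      (RamifiedWitt.map (π := π) ((restrictAlg O O').map ψ).hom)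
      (RamifiedWitt.map (π := π) ((restrictAlg O O').map φ).hom)
      (AlgHom.id O O') (AlgHom.id O O')) x

variable [IsLocalHom (algebraMap O O')]

/-- The morphism `u ⊗ id : W_O(B) ⊗_O O' → W_{O'}(B)`, natural in the `O'`-algebra `B`. -/
noncomputable def uRa (π : Uniformizer O) (ϖ : Uniformizer O') :
    wittTensorFunctor O' π ⟶ wittFunctor ϖ where
  app B :=
    letI := Algebra.compHom B (algebraMap O O')
    haveI : IsScalarTower O O' B := .of_algebraMap_eq fun _ => rfl
    CommRingCat.ofHom (RamifiedWitt.drinfeldTensor π ϖ B)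
  naturality {A B} φ := by
    let _ := Algebra.compHom A (algebraMap O O')
    let _ := Algebra.compHom B (algebraMap O O')
    have : IsScalarTower O O' A := .of_algebraMap_eq fun _ => rfl
    have : IsScalarTower O O' B := .of_algebraMap_eq fun _ => rfl
    have h := fun x => RamifiedWitt.drinfeldTensor_map (π := π) (A := A) (B := B) ϖ φ.hom x
    exact CommRingCat.hom_ext <| RingHom.ext fun x => h x

variable [Module.Finite O O'] [FaithfulSMul O O']

/-- The bijection `W_O(B) ^ e → W_O(B) ⊗_O O'`, `(b_i)_i ↦ ∑ b_i ⊗ ϖ ^ i`, for `O' / O` totally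
ramified of degree `e`. -/
noncomputable def tensorEquiv (h : IsTotallyRamified O O') (π : Uniformizer O)
    (ϖ : Uniformizer O') {e : ℕ} (he : Module.finrank O O' = e) (B : Type w) [CommRing B]
    [Algebra O B] : (Fin e → RamifiedWitt π B) ≃ RamifiedWitt π B ⊗[O] O' :=
  Equiv.ofBijective (fun b => ∑ i, b i ⊗ₜ[O] (ϖ.1 ^ (i : ℕ)))
    (h.sum_tmul_bijective ϖ.2 he (RamifiedWitt π B))

lemma tensorEquiv_map (h : IsTotallyRamified O O') (π : Uniformizer O)
    (ϖ : Uniformizer O') {e : ℕ} (he : Module.finrank O O' = e) {B C : Type w} [CommRing B]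
    [Algebra O B] [CommRing C] [Algebra O C] (φ : B →ₐ[O] C) (b : Fin e → RamifiedWitt π B) :
    tensorEquiv h π ϖ he C (fun i => RamifiedWitt.map φ (b i)) =
      Algebra.TensorProduct.map (RamifiedWitt.map φ) (AlgHom.id O O')
        (tensorEquiv h π ϖ he B b) := by
  simp only [tensorEquiv, Equiv.ofBijective_apply, map_sum, Algebra.TensorProduct.map_tmul, map_pow,
    AlgHom.id_apply]

lemma tensorEquiv_symm_map (h : IsTotallyRamified O O') (π : Uniformizer O)
    (ϖ : Uniformizer O') {e : ℕ} (he : Module.finrank O O' = e) {B C : Type w} [CommRing B]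
    [Algebra O B] [CommRing C] [Algebra O C] (φ : B →ₐ[O] C) (x : RamifiedWitt π B ⊗[O] O') :
    (tensorEquiv h π ϖ he C).symm
      (Algebra.TensorProduct.map (RamifiedWitt.map φ) (AlgHom.id O O') x) =
      fun i => RamifiedWitt.map φ ((tensorEquiv h π ϖ he B).symm x i) := by
  rw [Equiv.symm_apply_eq, tensorEquiv_map, Equiv.apply_symm_apply]

/-- The coordinates of `∑ b_i ⊗ ϖ ^ i` in `W_O(B) ⊗_O O'` are the Witt components of
`b_0, …, b_{e - 1}`; the coordinate with index `(n, i)` is the `n`-th component of `b_i`. -/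
noncomputable def wittTensorCoordinates (h : IsTotallyRamified O O') (π : Uniformizer O)
    (ϖ : Uniformizer O') {e : ℕ} (he : Module.finrank O O' = e)
    (R : Type v) [CommRing R] [Algebra O' R] :
    Coordinates (restrictAlg O' R ⋙ wittTensorFunctor O' π) (ℕ × Fin e) where
  equiv B := (tensorEquiv h π ϖ he ((restrictAlg O O').obj ((restrictAlg O' R).obj B))).symm.trans
      ⟨fun b p => (b p.2).coeff p.1, fun f i => ⟨fun n => f (n, i)⟩, fun _ => rfl, fun _ => rfl⟩
  naturality {B C} φ x i := by
    exact congrArg (fun b => (b i.2).coeff i.1) (tensorEquiv_symm_map h π ϖ he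
      ((restrictAlg O O').map ((restrictAlg O' R).map φ)).hom x)


open AlgebraicGeometry Limits

/-- A universal homeomorphism: every base change is a homeomorphism. -/
def IsUniversalHomeomorphism {X Y : Scheme.{v}} (f : X ⟶ Y) : Prop :=
  (topologically @IsHomeomorph).universally f

/-- A finite group scheme over `S` with exactly one point (the unit section provides it). -/
structure IsInfinitesimal {S : Scheme.{v}} (G : Grp (Over S)) : Prop where
  isFinite : IsFinite G.X.hom
  subsingleton : Subsingleton G.X.left

/-- A limit, in the category of group schemes, of a cofiltered system of infinitesimal group
schemes. -/
def IsProInfinitesimal {S : Scheme.{v}} (G : Grp (Over S)) : Prop :=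
  ∃ (J : Type v) (_ : SmallCategory J) (_ : IsCofiltered J) (F : J ⥤ Grp (Over S))
    (p : (Functor.const J).obj G ⟶ F),
    (∀ j, IsInfinitesimal (F.obj j)) ∧ Nonempty (IsLimit (Cone.mk G p))

/-- The functor from affine group schemes, given as group objects in the opposite category of
`R`-algebras, to group schemes over `Spec R`. -/
noncomputable def groupSchemeFunctor (R : CommRingCat.{v}) :
    Grp (CommAlgCat.{v} R)ᵒᵖ ⥤ Grp (Over (Spec R)) :=
  (algSpec R).mapGrp

variable (O') in
/-- The residue field of `O'` as an object of the category of commutative rings. -/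
abbrev residueRing := CommRingCat.of (ResidueField O')

/-- The special fibre of the scheme of ramified Witt vectors over `O'`, as an additive group
scheme over the residue field `k` of `O'`. -/
noncomputable def wittSpecial (ϖ : Uniformizer O') : Grp (Over (Spec (residueRing O'))) :=
  (groupSchemeFunctor (residueRing O')).obj (wittCoordinates ϖ (ResidueField O')).groupObj

/-- The scheme `Spec k[X_{n,i}; n ∈ ℕ, 0 ≤ i < e]` over the residue field `k` of `O'`, product of
`e` copies of the special fibre of the scheme of ramified Witt vectors over `O`, with the additive
group structure of `B ↦ W_O(B) ⊗_O O'`. -/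
noncomputable def wittTensorSpecial (h : IsTotallyRamified O O') (π : Uniformizer O)
    (ϖ : Uniformizer O') {e : ℕ} (he : Module.finrank O O' = e) : Grp (Over (Spec (residueRing O'))) :=
  (groupSchemeFunctor (residueRing O')).obj (wittTensorCoordinates h π ϖ he (ResidueField O')).groupObj

/-- The homomorphism of group schemes induced by `u ⊗ id` on the special fibres. -/
noncomputable def uRaSpecial (h : IsTotallyRamified O O') (π : Uniformizer O)
    (ϖ : Uniformizer O') {e : ℕ} (he : Module.finrank O O' = e) :
    wittTensorSpecial h π ϖ he ⟶ wittSpecial ϖ :=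
  (groupSchemeFunctor (residueRing O')).map (Coordinates.groupHom _ _
    (Functor.whiskerLeft (restrictAlg O' (ResidueField O')) (uRa π ϖ)))

end Functors

end Schemes

end RamWitt

/-!
On an algebra over the residue field of `O'`, multiplication by `ϖ` on `W_{O'}` is the composite of
the shift `V` with the Frobenius, which raises every component to the power `q`. Moreover
`u [b] = [b]` and `u (V b) = (π / ϖ) • V (u b)`. Write `π = η ϖ ^ e` with a unit `η`. Expanding
each `b_i` as `∑_n V ^ n [b_{i, n}]`, one finds that `u ⊗ id` sends `∑_i b_i ⊗ ϖ ^ i` to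
`∑_j η ^ ⌊j / e⌋ V ^ j [c_j]`, where `c_{n e + i}` is the power of `b_{i, n}` of exponent
`q ^ (n (e - 1) + i)`. The `c_j` are coordinates on `W_{O'}`, related to the Witt components by a
triangular change of variables, and in these coordinates `u ^ ra` merely raises each variable to a
power of the residue characteristic. Such a morphism is integral and surjective, and it is
radicial because raising to a power of the characteristic is injective on fields. Its kernel is
cut out by the vanishing of these powers, and it is the limit of the finite one-point group
schemes given by the first `N` Witt components.
-/

namespace RamifiedWitt

open RamWitt MvPolynomial IsLocalRing

section Verschiebung

variable {O : Type*} [CommRing O] [IsDomain O] [IsDiscreteValuationRing O]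
  {π : Uniformizer O} {A B : Type*} [CommRing A] [CommRing B] [Algebra O A] [Algebra O B]

/-- The shift `(b_0, b_1, …) ↦ (0, b_0, b_1, …)`, as a map of sets; see `verschiebung`. -/
def shift (b : RamifiedWitt π B) : RamifiedWitt π B :=
  ⟨fun n => n.casesOn 0 b.coeff⟩

/-- The left shift `(b_0, b_1, …) ↦ (b_1, b_2, …)`, which is not additive. -/
def tail (b : RamifiedWitt π B) : RamifiedWitt π B := ⟨fun n => b.coeff (n + 1)⟩

/-- The Teichmüller representative `[b] = (b, 0, 0, …)`. -/
def teichmuller (π : Uniformizer O) (b : B) : RamifiedWitt π B := ⟨fun n => n.casesOn b fun _ => 0⟩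

/-- The map raising all components to the power `q`. It is the Frobenius of `W_O(B)` only if `π`
vanishes in `B`, and no additivity is built in. -/
noncomputable def frobeniusFun (b : RamifiedWitt π B) : RamifiedWitt π B :=
  ⟨fun n => b.coeff n ^ residueCard O⟩

lemma ghost_eq_sum (b : RamifiedWitt π B) (n : ℕ) :
    b.ghost n = ∑ i ∈ Finset.range (n + 1),
      algebraMap O B π.1 ^ i * b.coeff i ^ residueCard O ^ (n - i) :=
  aeval_wittPhi π b.coeff n

lemma ghost_apply_zero (b : RamifiedWitt π B) : b.ghost 0 = b.coeff 0 := by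
  simp [ghost_eq_sum]

lemma ghost_shift_zero (b : RamifiedWitt π B) : b.shift.ghost 0 = 0 := by
  simp [ghost_eq_sum, shift]

lemma ghost_succ_eq_tail (b : RamifiedWitt π B) (n : ℕ) :
    b.ghost (n + 1) =
      b.coeff 0 ^ residueCard O ^ (n + 1) + algebraMap O B π.1 * b.tail.ghost n := by
  rw [ghost_eq_sum, ghost_eq_sum, Finset.sum_range_succ', Finset.mul_sum, add_comm]
  simp [tail, pow_succ' (algebraMap O B π.1), mul_assoc]

lemma ghost_succ_eq_frobeniusFun (b : RamifiedWitt π B) (n : ℕ) :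
    b.ghost (n + 1) = b.frobeniusFun.ghost n + algebraMap O B π.1 ^ (n + 1) * b.coeff (n + 1) := by
  rw [ghost_eq_sum, ghost_eq_sum, Finset.sum_range_succ, Nat.sub_self, pow_zero, pow_one]
  congr 1
  refine Finset.sum_congr rfl fun i hi => ?_
  rw [Nat.succ_sub (Nat.lt_succ_iff.1 (Finset.mem_range.1 hi)), pow_succ' (residueCard O), pow_mul]
  rfl

lemma coeff_iterate_tail {X : Type*} (b : RamifiedWitt π X) (m n : ℕ) :
    (tail^[m] b).coeff n = b.coeff (m + n) := by
  induction m generalizing n with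
  | zero => rw [Function.iterate_zero_apply, zero_add]
  | succ m ih => rw [Function.iterate_succ_apply', Nat.succ_add]; exact ih (n + 1)

variable [Finite (ResidueField O)]

lemma residueCard_pos : 0 < residueCard O := Nat.card_pos

lemma residueCard_pow_ne_zero (n : ℕ) : residueCard O ^ n ≠ 0 := pow_ne_zero _ residueCard_pos.ne'

lemma ghost_shift_succ (b : RamifiedWitt π B) (n : ℕ) :
    b.shift.ghost (n + 1) = algebraMap O B π.1 * b.ghost n := by
  rw [ghost_succ_eq_tail, show b.shift.coeff 0 = 0 from rfl, zero_pow (residueCard_pow_ne_zero _),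
    zero_add]
  rfl

lemma ghost_teichmuller (b : B) (n : ℕ) :
    (teichmuller π b).ghost n = b ^ residueCard O ^ n := by
  rw [ghost_eq_sum, Finset.sum_range_succ']
  simp [teichmuller, zero_pow (residueCard_pow_ne_zero _)]

lemma ghost_add (b c : RamifiedWitt π B) (n : ℕ) : (b + c).ghost n = b.ghost n + c.ghost n :=
  congrFun (map_add ghostHom b c) n

lemma ghost_sub (b c : RamifiedWitt π B) (n : ℕ) : (b - c).ghost n = b.ghost n - c.ghost n :=
  congrFun (map_sub ghostHom b c) n

lemma ghost_smul (r : O) (b : RamifiedWitt π B) (n : ℕ) :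
    (r • b).ghost n = algebraMap O B r * b.ghost n :=
  (congrFun (map_smul ghostHom r b) n).trans (Algebra.smul_def _ _)

lemma coeff_zero_add (b c : RamifiedWitt π B) : (b + c).coeff 0 = b.coeff 0 + c.coeff 0 := by
  simpa only [ghost_apply_zero] using ghost_add b c 0

lemma coeff_zero_smul (r : O) (b : RamifiedWitt π B) :
    (r • b).coeff 0 = algebraMap O B r * b.coeff 0 := by
  simpa only [ghost_apply_zero] using ghost_smul r b 0

lemma coeff_map (φ : A →ₐ[O] B) (b : RamifiedWitt π A) (n : ℕ) :
    (map φ b).coeff n = φ (b.coeff n) := rfl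

lemma map_shift (φ : A →ₐ[O] B) (b : RamifiedWitt π A) : map φ b.shift = (map φ b).shift := by
  ext n
  cases n
  · exact map_zero φ
  · rfl

lemma map_tail (φ : A →ₐ[O] B) (b : RamifiedWitt π A) :
    map φ b.tail = (map φ b).tail := rfl

lemma map_teichmuller (φ : A →ₐ[O] B) (b : A) :
    map φ (teichmuller π b) = teichmuller π (φ b) := by
  ext n
  cases n
  · rfl
  · exact map_zero φ

lemma map_frobeniusFun (φ : A →ₐ[O] B) (b : RamifiedWitt π A) :
    map φ b.frobeniusFun = (map φ b).frobeniusFun := by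
  ext n
  exact map_pow φ _ _

lemma exists_map_univ_eq (R : Type*) [CommRing R] [Algebra O R] [Algebra R B] [IsScalarTower O R B]
    {ι : Type*} (v : ι → RamifiedWitt π B) :
    ∃ φ : MvPolynomial (ι × ℕ) R →ₐ[R] B, ∀ i, map (φ.restrictScalars O) (univ π R ι i) = v i :=
  ⟨aeval fun p => (v p.1).coeff p.2, mapFun_univ v⟩

lemma shift_add (b c : RamifiedWitt π B) : (b + c).shift = b.shift + c.shift := by
  obtain ⟨φ, h⟩ := exists_map_univ_eq O ![b, c]
  rw [← show _ = b from h 0, ← show _ = c from h 1, ← map_add, ← map_shift, ← map_shift,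
    ← map_shift, ← map_add]
  congr 1
  refine ghost_ext isLeftRegular_algebraMap fun n => ?_
  cases n <;> simp only [ghost_add, ghost_shift_zero, ghost_shift_succ, mul_add, add_zero]

lemma shift_smul (r : O) (b : RamifiedWitt π B) : (r • b).shift = r • b.shift := by
  obtain ⟨φ, h⟩ := exists_map_univ_eq O ![b]
  rw [← show _ = b from h 0, ← map_smul, ← map_shift, ← map_shift, ← map_smul]
  congr 1
  refine ghost_ext isLeftRegular_algebraMap fun n => ?_
  cases n <;> simp only [ghost_smul, ghost_shift_zero, ghost_shift_succ, mul_zero, mul_left_comm]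

/-- The Verschiebung `V`, that is the shift as an `O`-linear endomorphism of `W_O(B)`. -/
@[simps]
def verschiebung : RamifiedWitt π B →ₗ[O] RamifiedWitt π B where
  toFun := shift
  map_add' := shift_add
  map_smul' := shift_smul

lemma verschiebung_pow_succ_apply (m : ℕ) (b : RamifiedWitt π B) :
    (verschiebung ^ (m + 1)) b = ((verschiebung ^ m) b).shift := by
  rw [pow_succ', Module.End.mul_apply, verschiebung_apply]

lemma verschiebung_pow_add_apply (m n : ℕ) (b : RamifiedWitt π B) :
    (verschiebung ^ (m + n)) b = (verschiebung ^ m) ((verschiebung ^ n) b) := by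
  rw [pow_add, Module.End.mul_apply]

lemma coeff_verschiebung_pow_of_lt (b : RamifiedWitt π B) {m n : ℕ} (h : n < m) :
    ((verschiebung ^ m) b).coeff n = 0 := by
  induction m generalizing n with
  | zero => exact absurd h n.not_lt_zero
  | succ m ih =>
    rw [verschiebung_pow_succ_apply]
    cases n with
    | zero => rfl
    | succ n => exact ih (Nat.lt_of_succ_lt_succ h)

lemma zero_coeff (n : ℕ) : (0 : RamifiedWitt π B).coeff n = 0 := by
  have h := coeff_verschiebung_pow_of_lt (0 : RamifiedWitt π B) n.lt_succ_self
  rwa [map_zero] at h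

lemma map_verschiebung_pow (φ : A →ₐ[O] B) (b : RamifiedWitt π A) (m : ℕ) :
    map φ ((verschiebung ^ m) b) = (verschiebung ^ m) (map φ b) := by
  induction m with
  | zero => rfl
  | succ m ih => rw [verschiebung_pow_succ_apply, verschiebung_pow_succ_apply, map_shift, ih]

lemma teichmuller_add_shift_tail (b : RamifiedWitt π B) :
    teichmuller π (b.coeff 0) + b.tail.shift = b := by
  obtain ⟨φ, h⟩ := exists_map_univ_eq O ![b]
  rw [← show _ = b from h 0, coeff_map, ← map_teichmuller, ← map_tail, ← map_shift, ← map_add]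
  congr 1
  refine ghost_ext isLeftRegular_algebraMap fun n => ?_
  cases n with
  | zero => rw [ghost_add, ghost_shift_zero, ghost_teichmuller, ghost_apply_zero, pow_zero, pow_one,
      add_zero]
  | succ n => rw [ghost_add, ghost_shift_succ, ghost_teichmuller, ghost_succ_eq_tail]

lemma coeff_teichmuller_add_shift_succ (a : B) (b : RamifiedWitt π B) (n : ℕ) :
    (teichmuller π a + b.shift).coeff (n + 1) = b.coeff n :=
  congrArg (fun x => x.coeff (n + 1)) <| teichmuller_add_shift_tail (π := π)
    ⟨fun n => n.casesOn (motive := fun _ => B) a b.coeff⟩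

lemma add_verschiebung_pow_succ (x y : RamifiedWitt π B) (m : ℕ) :
    x + (verschiebung ^ (m + 1)) y =
      teichmuller π (x.coeff 0) + (x.tail + (verschiebung ^ m) y).shift := by
  rw [shift_add, ← add_assoc, teichmuller_add_shift_tail, verschiebung_pow_succ_apply]

lemma coeff_add_verschiebung_pow_of_lt (x y : RamifiedWitt π B) {m j : ℕ} (hj : j < m) :
    (x + (verschiebung ^ m) y).coeff j = x.coeff j := by
  induction m generalizing x j with
  | zero => exact absurd hj j.not_lt_zero
  | succ m ih =>
    cases j with
    | zero => rw [coeff_zero_add, verschiebung_pow_succ_apply]; exact add_zero _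
    | succ j =>
      rw [add_verschiebung_pow_succ, coeff_teichmuller_add_shift_succ,
        ih x.tail (Nat.lt_of_succ_lt_succ hj)]
      rfl

lemma coeff_add_verschiebung_pow_self (x y : RamifiedWitt π B) (m : ℕ) :
    (x + (verschiebung ^ m) y).coeff m = x.coeff m + y.coeff 0 := by
  induction m generalizing x with
  | zero => exact coeff_zero_add x y
  | succ m ih =>
    rw [add_verschiebung_pow_succ, coeff_teichmuller_add_shift_succ, ih x.tail]
    rfl

lemma eq_sum_verschiebung_pow_teichmuller_add (b : RamifiedWitt π B) (N : ℕ) :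
    b = ∑ n ∈ Finset.range N, (verschiebung ^ n) (teichmuller π (b.coeff n)) +
      (verschiebung ^ N) (tail^[N] b) := by
  induction N with
  | zero => simp
  | succ N ih =>
    have hN : tail^[N] b = teichmuller π (b.coeff N) + verschiebung (tail^[N + 1] b) := by
      rw [Function.iterate_succ_apply', verschiebung_apply, ← add_zero N, ← coeff_iterate_tail,
        add_zero, teichmuller_add_shift_tail]
    conv_lhs => rw [ih, hN, map_add]
    rw [Finset.sum_range_succ, add_assoc, pow_succ, Module.End.mul_apply]

lemma coeff_add_congr {x x' y y' : RamifiedWitt π B} {N : ℕ}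
    (hx : ∀ n < N, x.coeff n = x'.coeff n) (hy : ∀ n < N, y.coeff n = y'.coeff n) {n : ℕ}
    (hn : n < N) : (x + y).coeff n = (x' + y').coeff n := by
  let s (z : RamifiedWitt π B) : RamifiedWitt π B :=
    ∑ i ∈ Finset.range N, (verschiebung ^ i) (teichmuller π (z.coeff i))
  have s_congr {z z' : RamifiedWitt π B} (hz : ∀ i < N, z.coeff i = z'.coeff i) : s z = s z' :=
    Finset.sum_congr rfl fun i hi => by rw [hz i (Finset.mem_range.1 hi)]
  have coeff_add (z w : RamifiedWitt π B) : (z + w).coeff n = (s z + s w).coeff n := by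
    conv_lhs => rw [z.eq_sum_verschiebung_pow_teichmuller_add N,
      w.eq_sum_verschiebung_pow_teichmuller_add N, add_add_add_comm, ← map_add,
      coeff_add_verschiebung_pow_of_lt _ _ hn]
  rw [coeff_add x, coeff_add x', s_congr hx, s_congr hy]

end Verschiebung

section Frobenius

variable {O : Type*} [CommRing O] [IsDomain O] [IsDiscreteValuationRing O]
  [Finite (ResidueField O)] {π : Uniformizer O} {B : Type*} [CommRing B] [Algebra O B]

lemma dvd_coeff_of_pow_succ_dvd_ghost {b : RamifiedWitt π B}
    (hπ : IsLeftRegular (algebraMap O B π.1))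
    (h : ∀ n, algebraMap O B π.1 ^ (n + 1) ∣ b.ghost n) (n : ℕ) :
    algebraMap O B π.1 ∣ b.coeff n := by
  induction n using Nat.strong_induction_on with
  | _ n ih =>
    have hn := h n
    rw [ghost_eq_sum, Finset.sum_range_succ, Nat.sub_self, pow_zero, pow_one] at hn
    have hs : algebraMap O B π.1 ^ (n + 1) ∣ ∑ i ∈ Finset.range n,
        algebraMap O B π.1 ^ i * b.coeff i ^ residueCard O ^ (n - i) := by
      refine Finset.dvd_sum fun i hi => ?_
      have hi := Finset.mem_range.1 hi
      have hq : n - i < residueCard O ^ (n - i) := Nat.lt_pow_self Finite.one_lt_card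
      refine (pow_dvd_pow _ (show n + 1 ≤ i + residueCard O ^ (n - i) by omega)).trans ?_
      rw [pow_add]
      exact mul_dvd_mul_left _ (pow_dvd_pow_of_dvd (ih i hi) _)
    obtain ⟨c, hc⟩ := (dvd_add_right hs).1 hn
    refine ⟨c, hπ.pow n ?_⟩
    simp only [hc, pow_succ, mul_assoc]

lemma pow_succ_dvd_ghost_smul_sub_shift_frobeniusFun (b : RamifiedWitt π B) (n : ℕ) :
    algebraMap O B π.1 ^ (n + 1) ∣ (π.1 • b - b.frobeniusFun.shift).ghost n := by
  rw [ghost_sub, ghost_smul]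
  cases n with
  | zero => rw [ghost_shift_zero, sub_zero, zero_add, pow_one]; exact dvd_mul_right _ _
  | succ n =>
    rw [ghost_shift_succ, ← mul_sub, ghost_succ_eq_frobeniusFun, add_sub_cancel_left, pow_succ']
    exact mul_dvd_mul_left _ (dvd_mul_right _ _)

theorem uniformizer_smul_eq_shift_frobeniusFun (hπ : algebraMap O B π.1 = 0)
    (b : RamifiedWitt π B) : π.1 • b = b.frobeniusFun.shift := by
  obtain ⟨φ, h⟩ := exists_map_univ_eq O ![b]
  set x := univ π O (Fin 1) 0
  have hx : map (φ.restrictScalars O) (π.1 • x - x.frobeniusFun.shift) = 0 := by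
    ext n
    obtain ⟨c, hc⟩ := dvd_coeff_of_pow_succ_dvd_ghost isLeftRegular_algebraMap
      (pow_succ_dvd_ghost_smul_sub_shift_frobeniusFun x) n
    rw [coeff_map, hc, map_mul, AlgHom.commutes, hπ, zero_mul, zero_coeff]
  rw [map_sub, map_smul, map_shift, map_frobeniusFun, sub_eq_zero] at hx
  rwa [← show _ = b from h 0]

lemma uniformizer_pow_smul_verschiebung_pow (hπ : algebraMap O B π.1 = 0) (b : RamifiedWitt π B)
    (m j : ℕ) :
    π.1 ^ j • (verschiebung ^ m) b = (verschiebung ^ (m + j)) (frobeniusFun^[j] b) := by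
  induction j generalizing m b with
  | zero => rw [pow_zero, one_smul]; rfl
  | succ j ih =>
    rw [pow_succ, mul_smul, ← map_smul, uniformizer_smul_eq_shift_frobeniusFun hπ,
      ← verschiebung_apply, ← Module.End.mul_apply, ← pow_succ, ih, Function.iterate_succ_apply,
      Nat.succ_add_eq_add_succ]

lemma iterate_frobeniusFun_teichmuller {R : Type*} [CommRing R] (b : R) (j : ℕ) :
    frobeniusFun^[j] (teichmuller π b) = teichmuller π (b ^ residueCard O ^ j) := by
  induction j generalizing b with
  | zero => rw [pow_zero, pow_one]; rfl
  | succ j ih =>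
    have hb : frobeniusFun (teichmuller π b) = teichmuller π (b ^ residueCard O) := by
      ext n
      cases n
      · rfl
      · exact zero_pow residueCard_pos.ne'
    rw [Function.iterate_succ_apply, hb, ih, ← pow_mul, ← pow_succ']

end Frobenius

section Series

variable {O : Type*} [CommRing O] [IsDomain O] [IsDiscreteValuationRing O]
  [Finite (ResidueField O)] {ϖ : Uniformizer O} {A B : Type*} [CommRing A] [CommRing B]
  [Algebra O A] [Algebra O B] (a : ℕ → Oˣ)

/-- The partial sums `∑_{j < m} a_j V ^ j [c_j]` of a series with unit coefficients `a_j`. -/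
noncomputable def partialSum (ϖ : Uniformizer O) (c : ℕ → B) (m : ℕ) : RamifiedWitt ϖ B :=
  ∑ j ∈ Finset.range m, (a j : O) • (verschiebung ^ j) (teichmuller ϖ (c j))

/-- The sum of the infinite series `∑_j a_j V ^ j [c_j]`. It is given by its components, the `m`-th
of which is already the one of any partial sum with more than `m` terms; see
`coeff_partialSum_of_lt`. -/
noncomputable def series (ϖ : Uniformizer O) (c : ℕ → B) : RamifiedWitt ϖ B :=
  ⟨fun m => (partialSum a ϖ c (m + 1)).coeff m⟩

lemma partialSum_succ (c : ℕ → B) (m : ℕ) : partialSum a ϖ c (m + 1) =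
    partialSum a ϖ c m + (verschiebung ^ m) ((a m : O) • teichmuller ϖ (c m)) := by
  rw [partialSum, Finset.sum_range_succ, ← map_smul]
  rfl

lemma partialSum_congr {c d : ℕ → B} {m : ℕ} (h : ∀ j < m, c j = d j) :
    partialSum a ϖ c m = partialSum a ϖ d m :=
  Finset.sum_congr rfl fun j hj => by rw [h j (Finset.mem_range.1 hj)]

lemma coeff_series (c : ℕ → B) (m : ℕ) : (series a ϖ c).coeff m =
    (partialSum a ϖ c m).coeff m + algebraMap O B (a m) * c m := by
  change (partialSum a ϖ c (m + 1)).coeff m = _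
  rw [partialSum_succ, coeff_add_verschiebung_pow_self, coeff_zero_smul]
  rfl

lemma coeff_partialSum_of_lt (c : ℕ → B) {m M : ℕ} (h : m < M) :
    (partialSum a ϖ c M).coeff m = (series a ϖ c).coeff m := by
  induction M, h using Nat.le_induction with
  | base => rfl
  | succ M hM ih => rw [partialSum_succ, coeff_add_verschiebung_pow_of_lt _ _ hM, ih]

lemma map_series (φ : A →ₐ[O] B) (c : ℕ → A) :
    map φ (series a ϖ c) = series a ϖ fun j => φ (c j) := by
  have h (m : ℕ) : map φ (partialSum a ϖ c m) = partialSum a ϖ (fun j => φ (c j)) m := by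
    simp only [partialSum, map_sum, map_smul, map_verschiebung_pow, map_teichmuller]
  ext m
  exact congrArg (fun x => x.coeff m) (h (m + 1))

lemma series_injective : Function.Injective (series (B := B) a ϖ) := by
  intro c d h
  funext m
  induction m using Nat.strong_induction_on with
  | _ m ih =>
    have hm := congrArg (fun x => x.coeff m) h
    simp only [coeff_series, partialSum_congr a ih, add_right_inj] at hm
    exact ((a m).isUnit.map (algebraMap O B)).mul_left_cancel hm

/-- The terms `c_j` of the expansion `w = ∑_j a_j V ^ j [c_j]`, computed recursively. -/
noncomputable def seriesTerm (w : RamifiedWitt ϖ B) (m : ℕ) : B :=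
  algebraMap O B ↑(a m)⁻¹ * (w.coeff m - (∑ j : Fin m,
    (a j : O) • (verschiebung ^ (j : ℕ)) (teichmuller ϖ (seriesTerm w j))).coeff m)
termination_by m
decreasing_by exact j.2

lemma series_seriesTerm (w : RamifiedWitt ϖ B) : series a ϖ (seriesTerm a w) = w := by
  ext m
  have h : seriesTerm a w m = algebraMap O B ↑(a m)⁻¹ *
      (w.coeff m - (partialSum a ϖ (seriesTerm a w) m).coeff m) := by
    rw [seriesTerm, Fin.sum_univ_eq_sum_range
      (fun j => (a j : O) • (verschiebung ^ j) (teichmuller ϖ (seriesTerm a w j))) m]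
    rfl
  rw [coeff_series, h, ← mul_assoc, ← map_mul, Units.mul_inv, map_one, one_mul,
    add_sub_cancel]

/-- Expansion of ramified Witt vectors in series `∑_j a_j V ^ j [c_j]` with fixed units `a_j`. -/
noncomputable def seriesEquiv (ϖ : Uniformizer O) (B : Type*) [CommRing B] [Algebra O B] :
    (ℕ → B) ≃ RamifiedWitt ϖ B :=
  Equiv.ofBijective (series a ϖ)
    ⟨series_injective a, fun w => ⟨seriesTerm a w, series_seriesTerm a w⟩⟩

@[simp]
lemma seriesEquiv_apply (c : ℕ → B) : seriesEquiv a ϖ B c = series a ϖ c := rfl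

lemma seriesEquiv_symm_map (φ : A →ₐ[O] B) (w : RamifiedWitt ϖ A) (j : ℕ) :
    (seriesEquiv a ϖ B).symm (map φ w) j = φ ((seriesEquiv a ϖ A).symm w j) := by
  obtain ⟨c, rfl⟩ := (seriesEquiv a ϖ A).surjective w
  rw [seriesEquiv_apply, map_series, ← seriesEquiv_apply, Equiv.symm_apply_apply,
    ← seriesEquiv_apply, Equiv.symm_apply_apply]

lemma series_zero : series (B := B) a ϖ 0 = 0 := by
  have h : teichmuller ϖ (0 : B) = 0 := by
    ext n
    rw [zero_coeff]
    cases n <;> rfl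
  ext m
  simp [series, partialSum, h, zero_coeff]

end Series

end RamifiedWitt

namespace RamWitt

open IsLocalRing

section TotallyRamified

variable {O O' : Type*} [CommRing O] [IsDomain O] [IsDiscreteValuationRing O]
  [CommRing O'] [IsDomain O'] [IsDiscreteValuationRing O']
  [Algebra O O'] [IsLocalHom (algebraMap O O')]

lemma IsTotallyRamified.residueDegree_eq_one (h : IsTotallyRamified O O') :
    residueDegree O O' = 1 := by
  rw [residueDegree, ← Module.finrank_self (ResidueField O)]
  exact (LinearEquiv.ofBijective (Algebra.linearMap _ _) h).finrank_eq.symm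

lemma IsTotallyRamified.residueCard_eq (h : IsTotallyRamified O O') :
    residueCard O' = residueCard O :=
  (Nat.card_congr (Equiv.ofBijective _ h)).symm

variable [Module.Finite O O']

lemma primesOver_maximalIdeal : (maximalIdeal O).primesOver O' = {maximalIdeal O'} := by
  refine Set.eq_singleton_iff_unique_mem.2 ⟨⟨inferInstance, inferInstance⟩, fun P hP => ?_⟩
  have := hP.1
  have := hP.2
  exact eq_maximalIdeal (.of_liesOver_isMaximal P (maximalIdeal O))

variable [FaithfulSMul O O']

lemma ramificationIdx_mul_residueDegree :
    (maximalIdeal O').ramificationIdx O * residueDegree O O' = Module.finrank O O' := by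
  have : Module.IsTorsionFree O O' := inferInstance
  let : Unique ((maximalIdeal O).primesOver O') :=
    (Equiv.setCongr primesOver_maximalIdeal).unique
  rw [← Ideal.sum_ramification_inertia_eq_finrank (maximalIdeal O) O', Fintype.sum_unique,
    Ideal.inertiaDeg_eq_of_isMaximal (maximalIdeal O)]
  rfl

theorem IsTotallyRamified.exists_unit_mul_pow (h : IsTotallyRamified O O') {π : O}
    (hπ : Irreducible π) {ϖ : O'} (hϖ : Irreducible ϖ) :
    ∃ η : O'ˣ, algebraMap O O' π = η * ϖ ^ Module.finrank O O' := by
  have hπ0 : algebraMap O O' π ≠ 0 :=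
    (FaithfulSMul.algebraMap_eq_zero_iff O O').not.2 hπ.ne_zero
  obtain ⟨m, η, hη⟩ := IsDiscreteValuationRing.eq_unit_mul_pow_irreducible hπ0 hϖ
  have hm : (maximalIdeal O).map (algebraMap O O') = maximalIdeal O' ^ m := by
    rw [hπ.maximalIdeal_eq, Ideal.map_span, Set.image_singleton, hη, hϖ.maximalIdeal_eq,
      Ideal.span_singleton_pow, Ideal.span_singleton_mul_left_unit η.isUnit]
  have hbot : (maximalIdeal O).map (algebraMap O O') ≠ ⊥ :=
    hm ▸ pow_ne_zero m (IsDiscreteValuationRing.not_a_field O')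
  have he : m = Module.finrank O O' := by
    rw [← ramificationIdx_mul_residueDegree, h.residueDegree_eq_one, mul_one,
      Ideal.IsDedekindDomain.ramificationIdx_eq_multiplicity (maximalIdeal O) _ hbot, hm,
      multiplicity_pow_self (IsDiscreteValuationRing.not_a_field O')]
    exact fun hu => (maximalIdeal.isMaximal O').ne_top (Ideal.isUnit_iff.1 hu)
  exact ⟨η, he ▸ hη⟩

end TotallyRamified

end RamWitt

namespace RamifiedWitt

open RamWitt MvPolynomial IsLocalRing

section Drinfeld

variable {O O' : Type*} [CommRing O] [IsDomain O] [IsDiscreteValuationRing O]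
  [CommRing O'] [IsDomain O'] [IsDiscreteValuationRing O']
  [Algebra O O'] [IsLocalHom (algebraMap O O')]
  [Finite (ResidueField O)] [Finite (ResidueField O')]
  {B : Type*} [CommRing B] [Algebra O B] [Algebra O' B] [IsScalarTower O O' B]
  {π : Uniformizer O} (ϖ : Uniformizer O')

lemma ghost_drinfeld (h : IsTotallyRamified O O') (b : RamifiedWitt π B) (n : ℕ) :
    (drinfeld ϖ b).ghost n = b.ghost n := by
  refine (ghost_drinfeldFun ϖ b n).trans ?_
  rw [h.residueDegree_eq_one, one_mul]

lemma drinfeld_teichmuller (h : IsTotallyRamified O O') (b : B) :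
    drinfeld ϖ (teichmuller π b) = teichmuller ϖ b := by
  let φ : MvPolynomial Unit O' →ₐ[O'] B := aeval fun _ => b
  have hφ : φ (X ()) = b := aeval_X _ _
  rw [← hφ, ← AlgHom.restrictScalars_apply O φ, ← map_teichmuller, drinfeld_map,
    AlgHom.restrictScalars_apply, ← map_teichmuller]
  congr 1
  refine ghost_ext isLeftRegular_algebraMap fun n => ?_
  rw [ghost_drinfeld ϖ h, ghost_teichmuller, ghost_teichmuller, h.residueCard_eq]

lemma drinfeld_shift (h : IsTotallyRamified O O') {ρ : O'}
    (hρ : algebraMap O O' π.1 = ρ * ϖ.1) (b : RamifiedWitt π B) :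
    drinfeld ϖ b.shift = ρ • (drinfeld ϖ b).shift := by
  obtain ⟨φ, hφ⟩ := exists_map_univ_eq O' ![b]
  rw [← show _ = b from hφ 0, ← map_shift, drinfeld_map, drinfeld_map, ← map_shift, ← map_smul]
  congr 1
  refine ghost_ext isLeftRegular_algebraMap fun n => ?_
  rw [ghost_drinfeld ϖ h, ghost_smul]
  cases n with
  | zero => rw [ghost_shift_zero, ghost_shift_zero, mul_zero]
  | succ n =>
    rw [ghost_shift_succ, ghost_shift_succ, ghost_drinfeld ϖ h, ← mul_assoc, ← map_mul, ← hρ,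
      ← IsScalarTower.algebraMap_apply]

lemma drinfeld_verschiebung_pow (h : IsTotallyRamified O O') {ρ : O'}
    (hρ : algebraMap O O' π.1 = ρ * ϖ.1) (b : RamifiedWitt π B) (m : ℕ) :
    drinfeld ϖ ((verschiebung ^ m) b) = ρ ^ m • (verschiebung ^ m) (drinfeld ϖ b) := by
  induction m with
  | zero => simp
  | succ m ih =>
    rw [verschiebung_pow_succ_apply, drinfeld_shift ϖ h hρ, ih, shift_smul, smul_smul,
      ← pow_succ', verschiebung_pow_succ_apply]

variable {η : O'ˣ} {e : ℕ} [NeZero e]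

lemma pow_smul_drinfeld_verschiebung_pow (h : IsTotallyRamified O O')
    (hη : algebraMap O O' π.1 = η * ϖ.1 ^ e) (hB : algebraMap O' B ϖ.1 = 0)
    (b : RamifiedWitt π B) (n i : ℕ) :
    ϖ.1 ^ i • drinfeld ϖ ((verschiebung ^ n) b) = (↑(η ^ n) : O') •
      (verschiebung ^ (n * e + i)) (frobeniusFun^[n * (e - 1) + i] (drinfeld ϖ b)) := by
  have he : e - 1 + 1 = e := Nat.sub_add_cancel NeZero.one_le
  have hρ : algebraMap O O' π.1 = (η * ϖ.1 ^ (e - 1)) * ϖ.1 := by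
    rw [hη, mul_assoc, ← pow_succ, he]
  have hn : n * e = n * (e - 1) + n := by rw [← Nat.mul_add_one, he]
  have hni : n + (n * (e - 1) + i) = n * e + i := by omega
  rw [drinfeld_verschiebung_pow ϖ h hρ, smul_smul, mul_pow, ← pow_mul, mul_left_comm, ← pow_add,
    mul_comm (e - 1), add_comm i, mul_smul, uniformizer_pow_smul_verschiebung_pow hB, hni,
    Units.val_pow_eq_pow_val]

/-- The exponent `q ^ (n (e - 1) + i)` attached to the coordinate `X_{n, i}`, where `q` is the
cardinality of the residue field of `O`: in suitable coordinates of `W_{O'}`, the morphism `u^ra`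
raises `X_{n, i}` to this power. -/
noncomputable def frobeniusExponent (O : Type*) [CommRing O] [IsDomain O]
    [IsDiscreteValuationRing O] {e : ℕ} (p : ℕ × Fin e) : ℕ :=
  residueCard O ^ (p.1 * (e - 1) + p.2)

lemma frobeniusExponent_pos {e : ℕ} (p : ℕ × Fin e) : 0 < frobeniusExponent O p :=
  pow_pos residueCard_pos _

lemma exists_pow_smul_drinfeld_eq (h : IsTotallyRamified O O')
    (hη : algebraMap O O' π.1 = η * ϖ.1 ^ e) (hB : algebraMap O' B ϖ.1 = 0)
    (b : RamifiedWitt π B) (i : Fin e) (N : ℕ) :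
    ∃ y, ϖ.1 ^ (i : ℕ) • drinfeld ϖ b =
      ∑ n ∈ Finset.range N, (↑(η ^ n) : O') • (verschiebung ^ (n * e + i))
        (teichmuller ϖ (b.coeff n ^ frobeniusExponent O (n, i))) + (verschiebung ^ (N * e)) y := by
  refine ⟨(verschiebung ^ (i : ℕ)) ((↑(η ^ N) : O') •
    frobeniusFun^[N * (e - 1) + i] (drinfeld ϖ (tail^[N] b))), ?_⟩
  conv_lhs => rw [b.eq_sum_verschiebung_pow_teichmuller_add N]
  rw [map_add, map_sum, smul_add, Finset.smul_sum,
    pow_smul_drinfeld_verschiebung_pow ϖ h hη hB, ← verschiebung_pow_add_apply, map_smul]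
  simp only [pow_smul_drinfeld_verschiebung_pow ϖ h hη hB, drinfeld_teichmuller ϖ h,
    iterate_frobeniusFun_teichmuller, h.residueCard_eq, frobeniusExponent]

lemma sum_range_mul_eq {M : Type*} [AddCommMonoid M] (e N : ℕ) (f : ℕ → M) :
    ∑ j ∈ Finset.range (N * e), f j =
      ∑ i : Fin e, ∑ n ∈ Finset.range N, f (n * e + i) := by
  rw [Finset.sum_comm]
  induction N with
  | zero => simp
  | succ N ih =>
    rw [Finset.sum_range_succ, add_one_mul, Finset.sum_range_add, ih,
      Fin.sum_univ_eq_sum_range fun i => f (N * e + i)]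

theorem sum_pow_smul_drinfeld_eq_series (h : IsTotallyRamified O O')
    (hη : algebraMap O O' π.1 = η * ϖ.1 ^ e) (hB : algebraMap O' B ϖ.1 = 0)
    (b : Fin e → RamifiedWitt π B) :
    ∑ i : Fin e, ϖ.1 ^ (i : ℕ) • drinfeld ϖ (b i) = series (fun j => η ^ (j / e)) ϖ fun j =>
      let p := Nat.divModEquiv e j
      (b p.2).coeff p.1 ^ frobeniusExponent O p := by
  set c : ℕ → B := fun j =>
    let p := Nat.divModEquiv e j
    (b p.2).coeff p.1 ^ frobeniusExponent O p
  have hc (n : ℕ) (i : Fin e) : c (n * e + i) = (b i).coeff n ^ frobeniusExponent O (n, i) := by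
    simp only [c, show Nat.divModEquiv e (n * e + i) = (n, i) from
      (Nat.divModEquiv e).apply_symm_apply (n, i)]
  have hdiv (n : ℕ) (i : Fin e) : (n * e + i) / e = n :=
    congrArg Prod.fst ((Nat.divModEquiv e).apply_symm_apply (n, i))
  ext m
  choose y hy using fun i => exists_pow_smul_drinfeld_eq ϖ h hη hB (b i) i (m + 1)
  have hm : m < (m + 1) * e :=
    m.lt_succ_self.trans_le (Nat.le_mul_of_pos_right _ (NeZero.pos e))
  have hsum : ∑ i : Fin e, ϖ.1 ^ (i : ℕ) • drinfeld ϖ (b i) =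
      partialSum (fun j => η ^ (j / e)) ϖ c ((m + 1) * e) +
        (verschiebung ^ ((m + 1) * e)) (∑ i, y i) := by
    simp only [hy, Finset.sum_add_distrib, map_sum, partialSum, sum_range_mul_eq, hc, hdiv]
  rw [hsum, coeff_add_verschiebung_pow_of_lt _ _ hm, coeff_partialSum_of_lt _ _ hm]

end Drinfeld

end RamifiedWitt

namespace RamWitt

section RepresentedGroups

open CategoryTheory Limits Opposite
open scoped MonObj MonoidalCategory

universe v u

section FullyFaithful

variable {C D J : Type*} [Category* C] [Category* D] [Category* J] {F : C ⥤ D}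

/-- The lift along a fully faithful functor `F` of a diagram whose objects are, up to the
isomorphisms `a`, images of given objects under `F`. -/
def liftDiagram (hF : F.FullyFaithful) (K : J ⥤ D) {X : J → C} (a : ∀ j, F.obj (X j) ≅ K.obj j) :
    J ⥤ C where
  obj := X
  map f := hF.preimage ((a _).hom ≫ K.map f ≫ (a _).inv)
  map_id j := hF.map_injective (by simp)
  map_comp f g := hF.map_injective (by simp)

variable (hF : F.FullyFaithful) {K : J ⥤ D} {X : J → C} (a : ∀ j, F.obj (X j) ≅ K.obj j)

/-- The image under `F` of the lift of a diagram. -/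
def liftDiagramIso : liftDiagram hF K a ⋙ F ≅ K :=
  NatIso.ofComponents a fun f =>
    (congrArg (· ≫ (a _).hom) (hF.map_preimage ((a _).hom ≫ K.map f ≫ (a _).inv))).trans
      (by rw [Category.assoc, Category.assoc, Iso.inv_hom_id, Category.comp_id]; rfl)

/-- The lift of a cone along a fully faithful functor. -/
def liftCone (c : Cone K) {Y : C} (b : F.obj Y ≅ c.pt) : Cone (liftDiagram hF K a) where
  pt := Y
  π :=
    { app j := hF.preimage (b.hom ≫ c.π.app j ≫ (a j).inv)
      naturality i j f := by
        have h : b.hom ≫ c.π.app j ≫ (a j).inv =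
            (b.hom ≫ c.π.app i ≫ (a i).inv) ≫ (a i).hom ≫ K.map f ≫ (a j).inv := by simp
        exact (Category.id_comp _).trans ((congrArg hF.preimage h).trans (hF.preimage_comp _ _)) }

/-- The lift of a limit cone along a fully faithful functor is a limit cone. -/
noncomputable def isLimitLiftCone {c : Cone K} (hc : IsLimit c) {Y : C} (b : F.obj Y ≅ c.pt) :
    IsLimit (liftCone hF a c b) := by
  have := hF.full
  have := hF.faithful
  refine isLimitOfReflects F ((IsLimit.postcomposeHomEquiv (liftDiagramIso hF a) _).1
    (hc.ofIsoLimit (Cone.ext b.symm fun j => ?_)))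
  have h := hF.map_preimage (b.hom ≫ c.π.app j ≫ (a j).inv)
  exact ((Iso.eq_inv_comp b).2 (by simp)).trans
    (congrArg (fun t => b.inv ≫ t ≫ (a j).hom) h.symm)

end FullyFaithful

section Kernel

variable {D : Type*} [Category* D] {P Q N : D ⥤ GrpCat.{v}}

/-- The objectwise kernel of a morphism of group valued functors. -/
def kernelFunctor (φ : P ⟶ Q) : D ⥤ GrpCat.{v} where
  obj B := GrpCat.of (φ.app B).hom.ker
  map {A B} f := GrpCat.ofHom (((P.map f).hom.comp (Subgroup.subtype _)).codRestrict _ fun x => by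
    have h := congrArg (fun g => g.hom x.1) (φ.naturality f)
    exact h.trans ((congrArg (Q.map f).hom x.2).trans (map_one _)))

/-- The inclusion of the objectwise kernel. -/
def kernelFunctorι (φ : P ⟶ Q) : kernelFunctor φ ⟶ P where
  app B := GrpCat.ofHom (Subgroup.subtype _)

/-- The factorization through the objectwise kernel of a morphism annihilated by `φ`. -/
def kernelFunctorLift (φ : P ⟶ Q) (ψ : N ⟶ P) (h : ∀ B x, φ.app B (ψ.app B x) = 1) :
    N ⟶ kernelFunctor φ where
  app B := GrpCat.ofHom ((ψ.app B).hom.codRestrict _ (h B))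
  naturality A B f := by
    ext x
    exact Subtype.ext (congrArg (fun g => g.hom x) (ψ.naturality f))

lemma kernelFunctorLift_comp_ι (φ : P ⟶ Q) (ψ : N ⟶ P) (h : ∀ B x, φ.app B (ψ.app B x) = 1) :
    kernelFunctorLift φ ψ h ≫ kernelFunctorι φ = ψ := rfl

instance (φ : P ⟶ Q) : Mono (kernelFunctorι φ) where
  right_cancellation f g h := by
    ext B x
    exact Subtype.ext (congrArg (fun t => (t.app B).hom x) h)

end Kernel

variable {C : Type u} [Category.{v} C] [CartesianMonoidalCategory C]

lemma comp_zero_hom_hom (G H : Grp C) {T : C} (f : T ⟶ G.X) :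
    f ≫ (0 : G ⟶ H).hom.hom = 1 := by
  change f ≫ CartesianMonoidalCategory.toUnit _ ≫ MonObj.one =
    CartesianMonoidalCategory.toUnit _ ≫ MonObj.one
  rw [← Category.assoc, CartesianMonoidalCategory.comp_toUnit]

section

variable {P Q : Cᵒᵖ ⥤ GrpCat.{v}} {G H K : Grp C} (b : yonedaGrp.obj G ≅ P)
  {c : yonedaGrp.obj H ≅ Q} {φ : P ⟶ Q} {f : G ⟶ H} (a : yonedaGrp.obj K ≅ kernelFunctor φ)

/-- The inclusion of a group object that represents an objectwise kernel. -/
noncomputable def kernelInclusion : K ⟶ G :=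
  yonedaGrpFullyFaithful.preimage (a.hom ≫ kernelFunctorι φ ≫ b.inv)

lemma app_app_eq_one_of_comp_eq_zero (hf : yonedaGrp.map f ≫ c.hom = b.hom ≫ φ) {N : Grp C}
    (k : N ⟶ G) (hk : k ≫ f = 0) (T : Cᵒᵖ) (x : (yonedaGrp.obj N).obj T) :
    φ.app T ((yonedaGrp.map k ≫ b.hom).app T x) = 1 := by
  have h : yonedaGrp.map k ≫ b.hom ≫ φ = yonedaGrp.map 0 ≫ c.hom := by
    rw [← hf, ← Category.assoc, ← Functor.map_comp, hk]
  refine (congrArg (fun t => (t.app T).hom x) h).trans ?_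
  exact (congrArg (c.hom.app T).hom (comp_zero_hom_hom N H x)).trans (map_one _)

lemma kernelInclusion_comp (hf : yonedaGrp.map f ≫ c.hom = b.hom ≫ φ) :
    kernelInclusion b a ≫ f = 0 := by
  refine yonedaGrp.map_injective ((cancel_mono c.hom).1 ?_)
  have h : yonedaGrp.map (kernelInclusion b a ≫ f) ≫ c.hom = a.hom ≫ kernelFunctorι φ ≫ φ := by
    rw [Functor.map_comp, Category.assoc, hf, kernelInclusion,
      yonedaGrpFullyFaithful.map_preimage, Category.assoc, Category.assoc, Iso.inv_hom_id_assoc]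
  rw [h]
  ext T x
  exact (a.hom.app T x).2.trans
    ((congrArg (c.hom.app T).hom (comp_zero_hom_hom K H x)).trans (map_one _)).symm

/-- A group object that represents the objectwise kernel is a kernel. -/
noncomputable def isLimitKernelInclusion (hf : yonedaGrp.map f ≫ c.hom = b.hom ≫ φ) :
    IsLimit (KernelFork.ofι (kernelInclusion b a) (kernelInclusion_comp b a hf)) :=
  KernelFork.IsLimit.ofι _ _
    (fun k hk => yonedaGrpFullyFaithful.preimage (kernelFunctorLift φ (yonedaGrp.map k ≫ b.hom)
      (app_app_eq_one_of_comp_eq_zero b hf k hk) ≫ a.inv))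
    (fun k hk => yonedaGrp.map_injective (by
      rw [Functor.map_comp, kernelInclusion, yonedaGrpFullyFaithful.map_preimage,
        yonedaGrpFullyFaithful.map_preimage, Category.assoc, Iso.inv_hom_id_assoc,
        ← Category.assoc, kernelFunctorLift_comp_ι, Category.assoc, Iso.hom_inv_id,
        Category.comp_id]))
    (fun k hk m hm => yonedaGrp.map_injective (by
      rw [yonedaGrpFullyFaithful.map_preimage, Iso.eq_comp_inv,
        ← cancel_mono (kernelFunctorι φ), kernelFunctorLift_comp_ι, ← hm, Functor.map_comp,
        kernelInclusion, yonedaGrpFullyFaithful.map_preimage]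
      simp only [Category.assoc, Iso.inv_hom_id, Category.comp_id]))

end

/-- The group object given by an object that represents a presheaf of groups. -/
def grpOfRepresentableBy (P : Cᵒᵖ ⥤ GrpCat.{v}) {X : C} (α : (P ⋙ forget _).RepresentableBy X) :
    Grp C :=
  letI := GrpObj.ofRepresentableBy X P α
  ⟨X⟩

/-- The presheaf of groups represented by `grpOfRepresentableBy P α` is `P`. -/
noncomputable def yonedaIso {P : Cᵒᵖ ⥤ GrpCat.{v}} {X : C}
    (α : (P ⋙ forget _).RepresentableBy X) : yonedaGrp.obj (grpOfRepresentableBy P α) ≅ P :=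
  yonedaGrpObjIsoOfRepresentableBy X P α

instance reflectsLimit_grpForget {J : Type*} [Category* J] (K : J ⥤ Grp C) :
    ReflectsLimit K (Grp.forget C) where
  reflects {c} hc := by
    let lift (s : Cone K) : s.pt.X ⟶ c.pt.X := hc.lift ((Grp.forget C).mapCone s)
    have lift_comp (s : Cone K) (j : J) : lift s ≫ (c.π.app j).hom.hom = (s.π.app j).hom.hom :=
      hc.fac ((Grp.forget C).mapCone s) j
    have isMonHom_lift (s : Cone K) : IsMonHom (lift s) :=
      { one_hom := hc.hom_ext fun j => by
          change (η ≫ lift s) ≫ (c.π.app j).hom.hom = η ≫ (c.π.app j).hom.hom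
          simp [lift_comp]
        mul_hom := hc.hom_ext fun j => by
          change (μ ≫ lift s) ≫ (c.π.app j).hom.hom =
            ((lift s ⊗ₘ lift s) ≫ μ) ≫ (c.π.app j).hom.hom
          rw [Category.assoc, Category.assoc, lift_comp, IsMonHom.mul_hom, IsMonHom.mul_hom,
            MonoidalCategory.tensorHom_comp_tensorHom_assoc, lift_comp] }
    exact ⟨{
      lift s := Grp.homMk (lift s)
      fac s j := Grp.hom_ext _ _ (lift_comp s j)
      uniq s m hm := Grp.hom_ext _ _
        (hc.uniq ((Grp.forget C).mapCone s) _ fun j => congrArg (fun f => f.hom.hom) (hm j)) }⟩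

end RepresentedGroups

section GroupSchemes

open CategoryTheory Limits AlgebraicGeometry

universe v

variable (R : CommRingCat.{v})

instance {J : Type*} [Category* J] [HasLimitsOfShape J (CommAlgCat.{v} R)ᵒᵖ] :
    PreservesLimitsOfShape J (groupSchemeFunctor R) where
  preservesLimit {K} := ⟨fun {c} hc => by
    have h : IsLimit ((Grp.forget _).mapCone ((groupSchemeFunctor R).mapCone c)) :=
      isLimitOfPreserves (algSpec R) (isLimitOfPreserves (Grp.forget _) hc)
    exact ⟨isLimitOfReflects (Grp.forget _) h⟩⟩

instance : (groupSchemeFunctor R).PreservesZeroMorphisms :=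
  have : (groupSchemeFunctor R).Full := inferInstanceAs (algSpec R).mapGrp.Full
  inferInstance

end GroupSchemes

section PowerQuotient

open MvPolynomial

/-- The quotient of the polynomial ring `R[X_p; p ∈ σ]` by the ideal generated by the powers
`X_p ^ δ_p`. -/
abbrev PowerQuotient (R : Type*) [CommRing R] {σ : Type*} (δ : σ → ℕ) :=
  MvPolynomial σ R ⧸ Ideal.span (Set.range fun p => (X p : MvPolynomial σ R) ^ δ p)

namespace PowerQuotient

variable {R : Type*} [CommRing R] {σ : Type*} (δ : σ → ℕ)

variable (R) in
/-- The class of the variable `X_p`. -/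
noncomputable def x (p : σ) : PowerQuotient R δ := Ideal.Quotient.mk _ (X p)

@[simp]
lemma x_pow (p : σ) : x R δ p ^ δ p = 0 := by
  rw [x, ← map_pow]
  exact Ideal.Quotient.eq_zero_iff_mem.2 (Ideal.subset_span ⟨p, rfl⟩)

variable {δ}

lemma induction_on {M : PowerQuotient R δ → Prop} (f : PowerQuotient R δ)
    (algebraMap : ∀ a, M (algebraMap R _ a)) (add : ∀ f g, M f → M g → M (f + g))
    (mul_x : ∀ f p, M f → M (f * x R δ p)) : M f := by
  obtain ⟨f, rfl⟩ := Ideal.Quotient.mk_surjective f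
  induction f using MvPolynomial.induction_on with
  | C a => exact algebraMap a
  | add f g hf hg => rw [map_add]; exact add _ _ hf hg
  | mul_X f p hf => rw [map_mul]; exact mul_x _ p hf

section Lift

variable {B : Type*} [CommRing B] [Algebra R B]

lemma algHom_ext {f g : PowerQuotient R δ →ₐ[R] B} (h : ∀ p, f (x R δ p) = g (x R δ p)) :
    f = g :=
  Ideal.Quotient.algHom_ext _ (MvPolynomial.algHom_ext h)

/-- The homomorphism of algebras that maps the variables to given elements `b_p` with
`b_p ^ δ_p = 0`. -/
noncomputable def lift (b : σ → B) (hb : ∀ p, b p ^ δ p = 0) : PowerQuotient R δ →ₐ[R] B :=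
  Ideal.Quotient.liftₐ _ (aeval b) fun f hf => by
    refine (Ideal.span_le.2 ?_ : _ ≤ RingHom.ker (aeval b)) hf
    rintro _ ⟨p, rfl⟩
    exact (map_pow _ _ _).trans (by rw [aeval_X, hb])

@[simp]
lemma lift_x (b : σ → B) (hb : ∀ p, b p ^ δ p = 0) (p : σ) :
    lift b hb (x R δ p) = b p :=
  aeval_X b p

variable (R δ B) in
/-- A homomorphism of algebras from a `PowerQuotient` amounts to the images `b_p` of the variables,
subject to `b_p ^ δ_p = 0`. -/
noncomputable def homEquiv :
    (PowerQuotient R δ →ₐ[R] B) ≃ {b : σ → B // ∀ p, b p ^ δ p = 0} where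
  toFun f := ⟨fun p => f (x R δ p), fun p => by rw [← map_pow, x_pow, map_zero]⟩
  invFun b := lift b.1 b.2
  left_inv _ := algHom_ext fun p => lift_x _ _ p
  right_inv b := Subtype.ext (funext (lift_x b.1 b.2))

end Lift

lemma finite [Finite σ] (hδ : ∀ p, 0 < δ p) : Module.Finite R (PowerQuotient R δ) := by
  have : Algebra.IsIntegral R (PowerQuotient R δ) := ⟨fun f => by
    induction f using induction_on with
    | algebraMap a => exact isIntegral_algebraMap
    | add f g hf hg => exact hf.add hg
    | mul_x f p hf => exact hf.mul (.of_pow (hδ p) ((x_pow (R := R) δ p).symm ▸ isIntegral_zero))⟩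
  exact Algebra.IsIntegral.finite

lemma subsingleton_primeSpectrum {k : Type*} [Field k] {δ : σ → ℕ} (hδ : ∀ p, 0 < δ p) :
    Subsingleton (PrimeSpectrum (PowerQuotient k δ)) := by
  let ε : PowerQuotient k δ →ₐ[k] k := lift 0 fun p => zero_pow (hδ p).ne'
  have sub_mem_nilradical (f) : f - algebraMap k _ (ε f) ∈ nilradical (PowerQuotient k δ) := by
    induction f using induction_on with
    | algebraMap a => simp
    | add f g hf hg => rw [map_add, map_add, add_sub_add_comm]; exact add_mem hf hg
    | mul_x f p _ =>
      rw [map_mul, lift_x, Pi.zero_apply, mul_zero, map_zero, sub_zero]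
      exact Ideal.mul_mem_left _ _ ⟨δ p, x_pow δ p⟩
  have isMaximal_ker : (RingHom.ker ε).IsMaximal :=
    RingHom.ker_isMaximal_of_surjective ε fun a => ⟨algebraMap k _ a, ε.commutes a⟩
  have ker_eq (P : PrimeSpectrum (PowerQuotient k δ)) : RingHom.ker ε = P.asIdeal :=
    isMaximal_ker.eq_of_le P.2.ne_top fun f hf => by
      have hmem := sub_mem_nilradical f
      rw [RingHom.mem_ker.1 hf, map_zero, sub_zero] at hmem
      exact nilradical_le_prime P.asIdeal hmem
  exact ⟨fun P Q => PrimeSpectrum.ext ((ker_eq P).symm.trans (ker_eq Q))⟩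

end PowerQuotient

end PowerQuotient

open CategoryTheory Limits Opposite AlgebraicGeometry

universe v

/-- Coordinates `b_p`, subject to the equations `b_p ^ δ_p = 0`, on a group valued functor on
`R`-algebras. -/
structure PowerCoordinates {R : Type v} [CommRing R] (P : CommAlgCat.{v} R ⥤ GrpCat.{v})
    {σ : Type} (δ : σ → ℕ) where
  /-- The coordinates of an element of `P(B)`. -/
  equiv (B : CommAlgCat.{v} R) : P.obj B ≃ {b : σ → B // ∀ p, b p ^ δ p = 0}
  naturality {B C : CommAlgCat.{v} R} (φ : B ⟶ C) (x : P.obj B) (p : σ) :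
    (equiv C (P.map φ x)).1 p = φ.hom ((equiv B x).1 p)

namespace PowerCoordinates

section

variable {R : Type v} [CommRing R] {P : CommAlgCat.{v} R ⥤ GrpCat.{v}} {σ : Type} {δ : σ → ℕ}
  (c : PowerCoordinates P δ)

/-- The coordinate with index `p` of an element of `P(B)`. -/
def coord {B : CommAlgCat.{v} R} (x : P.obj B) (p : σ) : B := (c.equiv B x).1 p

lemma coord_map {B C : CommAlgCat.{v} R} (φ : B ⟶ C) (x : P.obj B) (p : σ) :
    c.coord (P.map φ x) p = φ.hom (c.coord x p) :=
  c.naturality φ x p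

lemma coord_pow {B : CommAlgCat.{v} R} (x : P.obj B) (p : σ) : c.coord x p ^ δ p = 0 :=
  (c.equiv B x).2 p

lemma coord_injective {B : CommAlgCat.{v} R} : Function.Injective (c.coord (B := B)) :=
  fun _ _ h => (c.equiv B).injective (Subtype.ext h)

lemma coord_equiv_symm {B : CommAlgCat.{v} R} (b : {b : σ → B // ∀ p, b p ^ δ p = 0}) (p : σ) :
    c.coord ((c.equiv B).symm b) p = b.1 p :=
  congrFun (congrArg Subtype.val ((c.equiv B).apply_symm_apply b)) p

/-- A group valued functor with power coordinates is represented by a `PowerQuotient`. -/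
noncomputable def representableBy : ((unopUnop _ ⋙ P) ⋙ forget _).RepresentableBy
    (op (CommAlgCat.of R (PowerQuotient R δ))) where
  homEquiv {X} := (opEquiv _ _).trans (ConcreteCategory.homEquiv.trans
    ((PowerQuotient.homEquiv R δ X.unop).trans (c.equiv X.unop).symm))
  homEquiv_comp f g := (Equiv.symm_apply_eq _).2 <| Subtype.ext <| funext fun p =>
    ((c.coord_map f.unop _ p).trans (congrArg f.unop.hom (c.coord_equiv_symm
      (PowerQuotient.homEquiv R δ _ g.unop.hom) p))).symm

/-- With respect to a grading of the coordinates, the coordinates of degree less than `N` of a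
product depend only on the coordinates of degree less than `N` of the factors. -/
def IsTriangular (deg : σ → ℕ) : Prop :=
  ∀ ⦃B : CommAlgCat.{v} R⦄ ⦃x x' y y' : P.obj B⦄ (N : ℕ),
    (∀ p, deg p < N → c.coord x p = c.coord x' p) → (∀ p, deg p < N → c.coord y p = c.coord y' p) →
      ∀ p, deg p < N → c.coord (x * y) p = c.coord (x' * y') p

variable {c} {deg : σ → ℕ} (hc : c.IsTriangular deg)

/-- The congruence relation of having equal coordinates of degree less than `N`. -/
def truncCon (N : ℕ) (B : CommAlgCat.{v} R) : Con (P.obj B) where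
  r x y := ∀ p, deg p < N → c.coord x p = c.coord y p
  iseqv :=
    ⟨fun _ _ _ => rfl, fun h p hp => (h p hp).symm, fun h h' p hp => (h p hp).trans (h' p hp)⟩
  mul' hx hy := hc N hx hy

/-- The truncation of a group valued functor with triangular coordinates to the coordinates of
degree less than `N`. -/
def truncated (N : ℕ) : CommAlgCat.{v} R ⥤ GrpCat.{v} where
  obj B := GrpCat.of (truncCon hc N B).Quotient
  map {B C} φ := GrpCat.ofHom (Con.lift _ ((truncCon hc N C).mk'.comp (P.map φ).hom)
    fun x y hxy => (Con.eq _).2 fun p hp => (c.coord_map φ x p).trans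
      ((congrArg φ.hom (hxy p hp)).trans (c.coord_map φ y p).symm))
  map_id B := by
    ext x
    exact congrArg (fun f => (truncCon hc N B).mk' (f.hom x)) (P.map_id B)
  map_comp {_ _ D} φ ψ := by
    ext x
    exact congrArg (fun f => (truncCon hc N D).mk' (f.hom x)) (P.map_comp φ ψ)

/-- The inverse system of the truncations of a group valued functor with triangular
coordinates. -/
def truncation : (ULift.{v} ℕ)ᵒᵖ ⥤ CommAlgCat.{v} R ⥤ GrpCat.{v} where
  obj N := truncated hc N.unop.down
  map {M N} f :=
    { app B := GrpCat.ofHom (Con.map _ _ fun _ _ h p hp =>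
        h p (hp.trans_le (leOfHom f.unop : N.unop ≤ M.unop)))
      naturality B C φ := by ext ⟨x⟩; rfl }
  map_id N := by ext B ⟨x⟩; rfl
  map_comp f g := by ext B ⟨x⟩; rfl

/-- The projections of a group valued functor to its truncations. -/
def truncationCone : Cone (truncation hc) where
  pt := P
  π := { app N := { app B := GrpCat.ofHom (truncCon hc N.unop.down B).mk' } }

variable (hδ : ∀ p, 0 < δ p)

/-- The coordinates of degree less than `N` on a truncation. -/
noncomputable def truncatedCoordinates (N : ℕ) :
    PowerCoordinates (PowerCoordinates.truncated hc N) fun p : {p // deg p < N} => δ p where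
  equiv B := Equiv.ofBijective
    (Quotient.lift (fun x => ⟨fun p => c.coord x p, fun p => c.coord_pow x p⟩)
      fun _ _ h => Subtype.ext (funext fun p => h p p.2)) <| by
    refine ⟨?_, fun b => ?_⟩
    · rintro ⟨x⟩ ⟨y⟩ h
      exact Quotient.sound fun p hp => congrFun (congrArg Subtype.val h) ⟨p, hp⟩
    · let b' p : B := if hp : deg p < N then b.1 ⟨p, hp⟩ else 0
      have hb' p : b' p ^ δ p = 0 := by
        by_cases hp : deg p < N
        · rw [show b' p = b.1 ⟨p, hp⟩ from dif_pos hp, b.2 ⟨p, hp⟩]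
        · rw [show b' p = 0 from dif_neg hp, zero_pow (hδ p).ne']
      refine ⟨Quotient.mk _ ((c.equiv B).symm ⟨b', hb'⟩), Subtype.ext (funext fun p => ?_)⟩
      exact (c.coord_equiv_symm _ p.1).trans (dif_pos p.2)
  naturality {B C} φ := by
    rintro ⟨x⟩ p
    exact c.coord_map φ x p

/-- A group valued functor with triangular power coordinates is the limit of its truncations. -/
noncomputable def isLimitTruncationCone : IsLimit (truncationCone hc) := by
  refine evaluationJointlyReflectsLimits _ fun B => isLimitOfReflects (forget GrpCat) ?_
  refine ((Types.isLimit_iff _).2 fun s hs => ?_).some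
  choose x hx using fun N : ℕ => Con.mk'_surjective (c := truncCon hc N B) (s (op ⟨N⟩))
  have coord_x {M N : ℕ} (h : N ≤ M) (p : σ) (hp : deg p < N) :
      c.coord (x M) p = c.coord (x N) p := by
    have hMN := hs (homOfLE (show ULift.up.{v} N ≤ ULift.up M from h)).op
    rw [← hx M, ← hx N] at hMN
    exact (Con.eq (truncCon hc N B)).1 hMN p hp
  let y : P.obj B := (c.equiv B).symm ⟨fun p => c.coord (x (deg p + 1)) p, fun p => c.coord_pow _ p⟩
  have coord_y (p : σ) : c.coord y p = c.coord (x (deg p + 1)) p := c.coord_equiv_symm _ p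
  refine ⟨y, fun N => ?_, fun z hz => c.coord_injective (funext fun p => ?_)⟩
  · rw [← hx N.unop.down]
    exact (Con.eq _).2 fun p hp => (coord_y p).trans (coord_x hp p (Nat.lt_succ_self _)).symm
  · have hz' := (hz (op ⟨deg p + 1⟩)).trans (hx (deg p + 1)).symm
    exact ((Con.eq (truncCon hc _ B)).1 hz' p (Nat.lt_succ_self _)).trans (coord_y p).symm

end

variable {R : CommRingCat.{v}} {P : CommAlgCat.{v} R ⥤ GrpCat.{v}} {σ : Type} {δ : σ → ℕ}

/-- The affine group scheme represented by a group valued functor with power coordinates. -/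
noncomputable def groupObj (c : PowerCoordinates P δ) : Grp (CommAlgCat.{v} R)ᵒᵖ :=
  grpOfRepresentableBy _ c.representableBy

variable {c : PowerCoordinates P δ} {deg : σ → ℕ} (hc : c.IsTriangular deg) (hδ : ∀ p, 0 < δ p)

/-- The inverse system of the affine group schemes represented by the truncations of a group valued
functor with triangular power coordinates. -/
noncomputable def truncatedGroupObj : (ULift.{v} ℕ)ᵒᵖ ⥤ Grp (CommAlgCat.{v} R)ᵒᵖ :=
  liftDiagram yonedaGrpFullyFaithful
    (truncation hc ⋙ (Functor.whiskeringLeft _ _ _).obj (unopUnop _))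
    fun N => yonedaIso (truncatedCoordinates hc hδ N.unop.down).representableBy

/-- The limit cone of affine group schemes represented by the truncations of a group valued functor
with triangular power coordinates. -/
noncomputable def groupObjCone : Cone (truncatedGroupObj hc hδ) :=
  liftCone yonedaGrpFullyFaithful _
    (((Functor.whiskeringLeft _ _ _).obj (unopUnop _)).mapCone (truncationCone hc))
    (yonedaIso c.representableBy)

/-- The group scheme of a group valued functor with triangular power coordinates is the limit of
the group schemes of its truncations. -/
noncomputable def isLimitMapGroupObjCone :
    IsLimit ((groupSchemeFunctor R).mapCone (groupObjCone hc hδ)) :=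
  isLimitOfPreserves _ (isLimitLiftCone _ _ (isLimitOfPreserves _ (isLimitTruncationCone hc)) _)

end PowerCoordinates

lemma IsProInfinitesimal.of_iso {S : Scheme.{v}} {G H : Grp (Over S)} (i : G ≅ H)
    (hH : IsProInfinitesimal H) : IsProInfinitesimal G := by
  obtain ⟨J, _, _, F, p, hF, ⟨hp⟩⟩ := hH
  exact ⟨J, _, inferInstance, F, (Functor.const J).map i.hom ≫ p, hF,
    ⟨hp.ofIsoLimit (Cone.ext i.symm fun j => (i.inv_hom_id_assoc _).symm)⟩⟩

section Field

open PowerCoordinates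

variable {k : Type v} [Field k] {P : CommAlgCat.{v} k ⥤ GrpCat.{v}} {σ : Type} {δ : σ → ℕ}
  (c : PowerCoordinates P δ)

lemma PowerCoordinates.isInfinitesimal [Finite σ] (hδ : ∀ p, 0 < δ p) :
    IsInfinitesimal ((groupSchemeFunctor (.of k)).obj c.groupObj) where
  isFinite := (IsFinite.SpecMap_iff (f := CommRingCat.ofHom (algebraMap k (PowerQuotient k δ)))).2
    (RingHom.finite_algebraMap.2 (PowerQuotient.finite hδ))
  subsingleton := PowerQuotient.subsingleton_primeSpectrum hδ

variable {c} {deg : σ → ℕ} [∀ N, Finite {p // deg p < N}]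

lemma PowerCoordinates.IsTriangular.isProInfinitesimal (hc : c.IsTriangular deg)
    (hδ : ∀ p, 0 < δ p) : IsProInfinitesimal ((groupSchemeFunctor (.of k)).obj c.groupObj) := by
  refine ⟨(ULift.{v} ℕ)ᵒᵖ, inferInstance, inferInstance, _,
    ((groupSchemeFunctor (.of k)).mapCone (groupObjCone hc hδ)).π, fun N => ?_,
    ⟨isLimitMapGroupObjCone (R := .of k) hc hδ⟩⟩
  exact (truncatedCoordinates hc hδ N.unop.down).isInfinitesimal fun p => hδ p

end Field

namespace Coordinates

variable {R : CommRingCat.{v}} {F G H : CommAlgCat.{v} R ⥤ CommRingCat.{v}} {σ τ υ : Type}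

section Hom

/-- The homomorphism of presheaves of additive groups given by a morphism of ring valued
functors. -/
def presheafMap (α : F ⟶ G) : presheaf F ⟶ presheaf G :=
  Functor.whiskerLeft (unopUnop _) (Functor.whiskerRight α addGroupFunctor)

/-- The affine group scheme attached to coordinates represents the additive group of the functor. -/
noncomputable def yonedaIso (c : Coordinates F σ) : yonedaGrp.obj c.groupObj ≅ presheaf F :=
  RamWitt.yonedaIso c.representableBy

lemma yonedaGrp_map_groupHom (c : Coordinates F σ) (d : Coordinates G τ) (α : F ⟶ G) :
    yonedaGrp.map (c.groupHom d α) = c.yonedaIso.hom ≫ presheafMap α ≫ d.yonedaIso.inv :=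
  yonedaGrpFullyFaithful.map_preimage _

lemma groupHom_id (c : Coordinates F σ) : c.groupHom c (𝟙 F) = 𝟙 _ :=
  yonedaGrp.map_injective (by
    rw [yonedaGrp_map_groupHom, show presheafMap (𝟙 F) = 𝟙 _ from rfl, Category.id_comp,
      Iso.hom_inv_id, yonedaGrp.map_id])

lemma groupHom_comp (c : Coordinates F σ) (d : Coordinates G τ) (d' : Coordinates H υ) (α : F ⟶ G)
    (β : G ⟶ H) : c.groupHom d α ≫ d.groupHom d' β = c.groupHom d' (α ≫ β) :=
  yonedaGrp.map_injective (by
    simp only [yonedaGrp.map_comp, yonedaGrp_map_groupHom,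
      show presheafMap (α ≫ β) = presheafMap α ≫ presheafMap β from rfl, Category.assoc,
      Iso.inv_hom_id_assoc])

instance (c : Coordinates F σ) (d : Coordinates F τ) : IsIso (c.groupHom d (𝟙 F)) :=
  ⟨d.groupHom c (𝟙 F), by rw [groupHom_comp, Category.id_comp, groupHom_id],
    by rw [groupHom_comp, Category.id_comp, groupHom_id]⟩

lemma yonedaGrp_map_groupHom_comp (c : Coordinates F σ) (d : Coordinates G τ) (α : F ⟶ G) :
    yonedaGrp.map (c.groupHom d α) ≫ d.yonedaIso.hom = c.yonedaIso.hom ≫ presheafMap α := by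
  rw [yonedaGrp_map_groupHom, Category.assoc, Category.assoc, Iso.inv_hom_id, Category.comp_id]

end Hom

/-- The kernel of a homomorphism of group schemes is the group scheme of the kernel of the
homomorphism of group valued functors. -/
noncomputable def kernelGroupHomIso (c : Coordinates F σ) (d : Coordinates G τ) (α : F ⟶ G)
    {δ : σ → ℕ}
    (k : PowerCoordinates (kernelFunctor (Functor.whiskerRight α addGroupFunctor)) δ) :
    kernel ((groupSchemeFunctor R).map (c.groupHom d α)) ≅ (groupSchemeFunctor R).obj k.groupObj :=
  (limit.isLimit _).conePointUniqueUpToIso (KernelFork.mapIsLimit _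
    (isLimitKernelInclusion c.yonedaIso (RamWitt.yonedaIso k.representableBy)
      (c.yonedaGrp_map_groupHom_comp d α)) (groupSchemeFunctor R))

variable {c : Coordinates F σ} {d : Coordinates G σ} {α : F ⟶ G} {δ : σ → ℕ}

/-- The kernel of a homomorphism that raises the coordinates to the powers `δ` consists of the
elements whose coordinates have vanishing powers. -/
def kernelCoordinates (hα : ∀ B x p, d.equiv B (α.app B x) p = c.equiv B x p ^ δ p)
    (hd : ∀ B, d.equiv B 0 = 0) :
    PowerCoordinates (kernelFunctor (Functor.whiskerRight α addGroupFunctor)) δ where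
  equiv B := (Multiplicative.toAdd.trans (c.equiv B)).subtypeEquiv fun x => by
    refine ((d.equiv B).apply_eq_iff_eq (x := α.app B x) (y := 0)).symm.trans ?_
    rw [hd, funext_iff]
    exact forall_congr' fun p => Eq.congr_left (hα B x.toAdd p)
  naturality φ x := c.naturality φ x.1

/-- With respect to a grading of the coordinates, the coordinates of degree less than `N` of a sum
depend only on the coordinates of degree less than `N` of the summands. -/
def IsTriangular (c : Coordinates F σ) (deg : σ → ℕ) : Prop :=
  ∀ ⦃B : CommAlgCat.{v} R⦄ ⦃x x' y y' : F.obj B⦄ (N : ℕ),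
    (∀ p, deg p < N → c.equiv B x p = c.equiv B x' p) →
      (∀ p, deg p < N → c.equiv B y p = c.equiv B y' p) →
        ∀ p, deg p < N → c.equiv B (x + y) p = c.equiv B (x' + y') p

lemma IsTriangular.kernelCoordinates {deg : σ → ℕ} (hc : c.IsTriangular deg)
    (hα : ∀ B x p, d.equiv B (α.app B x) p = c.equiv B x p ^ δ p) (hd : ∀ B, d.equiv B 0 = 0) :
    (kernelCoordinates hα hd).IsTriangular deg :=
  fun _ _ _ _ _ N hx hy => hc N hx hy

end Coordinates

open MvPolynomial

section PowerAlgHom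

lemma isUniversalHomeomorphism_of_isIntegralHom {X Y : Scheme.{v}} (f : X ⟶ Y) [IsIntegralHom f]
    [Surjective f] [UniversallyInjective f] : IsUniversalHomeomorphism f := by
  intro X' Y' i₁ i₂ f' h
  have isIntegralHom : IsIntegralHom f' := MorphismProperty.of_isPullback h.flip inferInstance
  have surjective : Surjective f' := MorphismProperty.of_isPullback h.flip inferInstance
  have injective : UniversallyInjective f' := MorphismProperty.of_isPullback h.flip inferInstance
  exact isHomeomorph_iff_continuous_isClosedMap_bijective.2
    ⟨f'.continuous, f'.isClosedMap, f'.injective, f'.surjective⟩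

/-- The endomorphism of a polynomial ring that raises the variables to the powers `δ`. -/
noncomputable def powerAlgHom (R : Type*) [CommRing R] {σ : Type*} (δ : σ → ℕ) :
    MvPolynomial σ R →ₐ[R] MvPolynomial σ R :=
  aeval fun p => X p ^ δ p

variable {R : Type v} [CommRing R] {σ : Type} {δ : σ → ℕ}

lemma powerAlgHom_X (p : σ) : powerAlgHom R δ (X p) = X p ^ δ p := aeval_X _ p

lemma powerAlgHom_isIntegral (hδ : ∀ p, 0 < δ p) : (powerAlgHom R δ).toRingHom.IsIntegral := by
  let := (powerAlgHom R δ).toRingHom.toAlgebra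
  intro f
  change IsIntegral (MvPolynomial σ R) f
  induction f using MvPolynomial.induction_on with
  | C a => exact (powerAlgHom R δ).commutes a ▸
      isIntegral_algebraMap (A := MvPolynomial σ R) (x := (C a : MvPolynomial σ R))
  | add f g hf hg => exact hf.add hg
  | mul_X f p hf =>
    refine hf.mul (.of_pow (hδ p) ?_)
    exact powerAlgHom_X (R := R) (δ := δ) p ▸
      isIntegral_algebraMap (A := MvPolynomial σ R) (x := (X p : MvPolynomial σ R))

lemma powerAlgHom_injective (hδ : ∀ p, 0 < δ p) : Function.Injective (powerAlgHom R δ) := by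
  have := (algebraicIndependent_X σ R).polynomial_aeval_of_transcendental
    (f := fun p => Polynomial.X ^ δ p) fun p => (Polynomial.transcendental_X R).pow (hδ p)
  simp only [map_pow, Polynomial.aeval_X] at this
  exact this

lemma ringHom_eq_of_comp_powerAlgHom_eq (ℓ : ℕ) [hℓ : Fact ℓ.Prime] [CharP R ℓ]
    (hδ : ∀ p, ∃ n, δ p = ℓ ^ n) {K : Type*} [Field K] {f g : MvPolynomial σ R →+* K}
    (h : ∀ x, f (powerAlgHom R δ x) = g (powerAlgHom R δ x)) : f = g := by
  have : CharP K ℓ := (CharP.charP_iff_prime_eq_zero hℓ.out).2 (by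
    rw [← map_natCast (f.comp C), CharP.cast_eq_zero, map_zero])
  refine ringHom_ext (fun a => by simpa using h (C a)) fun p => ?_
  obtain ⟨n, hn⟩ := hδ p
  have hp := h (X p)
  rw [powerAlgHom_X, map_pow, map_pow, hn] at hp
  exact iterateFrobenius_inj K ℓ n hp

theorem isUniversalHomeomorphism_Spec_map_powerAlgHom (ℓ : ℕ) [hℓ : Fact ℓ.Prime] [CharP R ℓ]
    (hδ : ∀ p, ∃ n, δ p = ℓ ^ n) :
    IsUniversalHomeomorphism (Spec.map (CommRingCat.ofHom (powerAlgHom R δ).toRingHom)) := by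
  have δ_pos (p : σ) : 0 < δ p := by
    obtain ⟨n, hn⟩ := hδ p
    exact hn ▸ pow_pos hℓ.out.pos n
  have isIntegralHom : IsIntegralHom (Spec.map (CommRingCat.ofHom (powerAlgHom R δ).toRingHom)) :=
    IsIntegralHom.SpecMap_iff.2 (powerAlgHom_isIntegral δ_pos)
  have surjective : Surjective (Spec.map (CommRingCat.ofHom (powerAlgHom R δ).toRingHom)) :=
    ⟨(powerAlgHom_isIntegral δ_pos).comap_surjective (powerAlgHom_injective δ_pos)⟩
  have injective : UniversallyInjective
      (Spec.map (CommRingCat.ofHom (powerAlgHom R δ).toRingHom)) := by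
    refine ((tfae_universallyInjective _).out 0 1).2 fun K [Field K] f g h => ?_
    obtain ⟨f, rfl⟩ := Spec.map_surjective f
    obtain ⟨g, rfl⟩ := Spec.map_surjective g
    simp only [← Spec.map_comp] at h
    have hom_eq : f.hom = g.hom := ringHom_eq_of_comp_powerAlgHom_eq ℓ hδ fun x =>
      congrArg (fun φ => φ.hom x) (Spec.map_injective h)
    exact congrArg Spec.map (CommRingCat.hom_ext hom_eq)
  exact isUniversalHomeomorphism_of_isIntegralHom _

end PowerAlgHom

namespace Coordinates

variable {R : CommRingCat.{v}} {F G : CommAlgCat.{v} R ⥤ CommRingCat.{v}} {σ τ : Type}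
  {c : Coordinates F σ} {d : Coordinates G σ} {α : F ⟶ G} {δ : σ → ℕ}

lemma groupHom_hom_hom (hα : ∀ B x p, d.equiv B (α.app B x) p = c.equiv B x p ^ δ p) :
    (c.groupHom d α).hom.hom = (CommAlgCat.ofHom (powerAlgHom R δ)).op := by
  refine Quiver.Hom.unop_inj (CommAlgCat.hom_ext (algHom_ext fun p => ?_))
  let S := CommAlgCat.of R (MvPolynomial σ R)
  have generic : (d.equiv S).symm (fun p => (c.groupHom d α).hom.hom.unop.hom (X p)) =
      α.app S ((c.equiv S).symm X) :=
    congrArg (fun t => ((t.app (op (op S))).hom (𝟙 _)).toAdd) (c.yonedaGrp_map_groupHom_comp d α)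
  refine (congrFun ((Equiv.symm_apply_eq _).1 generic) p).trans ?_
  rw [hα, Equiv.apply_symm_apply]
  exact (powerAlgHom_X p).symm

lemma groupSchemeFunctor_map_groupHom_left
    (hα : ∀ B x p, d.equiv B (α.app B x) p = c.equiv B x p ^ δ p) :
    ((groupSchemeFunctor R).map (c.groupHom d α)).hom.hom.left =
      Spec.map (CommRingCat.ofHom (powerAlgHom R δ).toRingHom) := by
  change ((algSpec R).map (c.groupHom d α).hom.hom).left = _
  rw [groupHom_hom_hom hα]
  rfl

theorem isUniversalHomeomorphism_groupHom
    (hα : ∀ B x p, d.equiv B (α.app B x) p = c.equiv B x p ^ δ p) (ℓ : ℕ) [Fact ℓ.Prime]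
    [CharP R ℓ] (hδ : ∀ p, ∃ n, δ p = ℓ ^ n) (d' : Coordinates G τ) :
    IsUniversalHomeomorphism ((groupSchemeFunctor R).map (c.groupHom d' α)).hom.hom.left := by
  have map_eq : ((groupSchemeFunctor R).map (c.groupHom d' α)).hom.hom.left =
      Spec.map (CommRingCat.ofHom (powerAlgHom R δ).toRingHom) ≫
        ((groupSchemeFunctor R).map (d.groupHom d' (𝟙 G))).hom.hom.left := by
    rw [← groupSchemeFunctor_map_groupHom_left hα, ← Category.comp_id α, ← groupHom_comp c d d',
      Functor.map_comp, Category.comp_id]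
    rfl
  have isIso : IsIso ((groupSchemeFunctor R).map (d.groupHom d' (𝟙 G))).hom.hom.left :=
    inferInstanceAs (IsIso ((Grp.forget _ ⋙ Over.forget (Spec R)).map
      ((groupSchemeFunctor R).map (d.groupHom d' (𝟙 G)))))
  rw [map_eq]
  exact ((topologically @IsHomeomorph).universally.cancel_right_of_respectsIso _
    ((groupSchemeFunctor R).map (d.groupHom d' (𝟙 G))).hom.hom.left).2
    (isUniversalHomeomorphism_Spec_map_powerAlgHom ℓ hδ)

end Coordinates

end RamWitt

namespace RamWitt

open IsLocalRing CategoryTheory Limits RamifiedWitt AlgebraicGeometry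
open scoped TensorProduct

universe v u

section SeriesCoordinates

variable {O : Type u} [CommRing O] [IsDomain O] [IsDiscreteValuationRing O]
  [Finite (ResidueField O)] {σ : Type}

/-- The terms `c_j` of the expansion `∑_j a_j V ^ j [c_j]`, reindexed by `r`, as coordinates of the
Witt vector functor. -/
noncomputable def seriesCoordinates (a : ℕ → Oˣ) (π : Uniformizer O) (r : ℕ ≃ σ) (R : Type v)
    [CommRing R] [Algebra O R] : Coordinates (restrictAlg O R ⋙ wittFunctor π) σ where
  equiv B := (seriesEquiv a π ((restrictAlg O R).obj B)).symm.trans (r.arrowCongr (.refl _))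
  naturality φ x p := seriesEquiv_symm_map a ((restrictAlg O R).map φ).hom x (r.symm p)

lemma seriesCoordinates_zero (a : ℕ → Oˣ) (π : Uniformizer O) (r : ℕ ≃ σ) {R : Type v}
    [CommRing R] [Algebra O R] (B : CommAlgCat.{v} R) :
    (seriesCoordinates a π r R).equiv B 0 = 0 := by
  let _ := Algebra.compHom B (algebraMap O R)
  have h : (seriesEquiv a π B).symm 0 = 0 := (Equiv.symm_apply_eq _).2 (series_zero a).symm
  exact funext fun p => congrFun h (r.symm p)

end SeriesCoordinates

variable {O : Type u} [CommRing O] [IsDomain O] [IsDiscreteValuationRing O]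
  [Finite (ResidueField O)] {O' : Type v} [CommRing O'] [IsDomain O'] [IsDiscreteValuationRing O']
  [Algebra O O'] [Module.Finite O O'] [FaithfulSMul O O']
  (h : IsTotallyRamified O O') (π : Uniformizer O) (ϖ : Uniformizer O') {e : ℕ}
  (he : Module.finrank O O' = e)

lemma tensorEquiv_symm_add {B : Type*} [CommRing B] [Algebra O B]
    (x y : RamifiedWitt π B ⊗[O] O') : (tensorEquiv h π ϖ he B).symm (x + y) =
      (tensorEquiv h π ϖ he B).symm x + (tensorEquiv h π ϖ he B).symm y := by
  rw [Equiv.symm_apply_eq]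
  have add (b c : Fin e → RamifiedWitt π B) : tensorEquiv h π ϖ he B (b + c) =
      tensorEquiv h π ϖ he B b + tensorEquiv h π ϖ he B c := by
    simp only [tensorEquiv, Equiv.ofBijective_apply, Pi.add_apply, TensorProduct.add_tmul,
      Finset.sum_add_distrib]
  rw [add, Equiv.apply_symm_apply, Equiv.apply_symm_apply]

variable [Finite (ResidueField O')]

lemma isTriangular_wittTensorCoordinates (R : Type v) [CommRing R] [Algebra O' R] :
    (wittTensorCoordinates h π ϖ he R).IsTriangular (R := .of R) Prod.fst := by
  intro B x x' y y' N hx hy p hp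
  let B₀ := (restrictAlg O O').obj ((restrictAlg O' R).obj B)
  have add := congrFun (tensorEquiv_symm_add h π ϖ he (B := B₀) x y) p.2
  have add' := congrFun (tensorEquiv_symm_add h π ϖ he (B := B₀) x' y') p.2
  exact (congrArg (coeff · p.1) add).trans ((coeff_add_congr (fun n hn => hx (n, p.2) hn)
    (fun n hn => hy (n, p.2) hn) hp).trans (congrArg (coeff · p.1) add').symm)

lemma drinfeldTensor_tensorEquiv {B : Type*} [CommRing B] [Algebra O B] [Algebra O' B]
    [IsScalarTower O O' B] (b : Fin e → RamifiedWitt π B) :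
    drinfeldTensor π ϖ B (tensorEquiv h π ϖ he B b) =
      ∑ i : Fin e, ϖ.1 ^ (i : ℕ) • drinfeld ϖ (b i) := by
  simp only [tensorEquiv, Equiv.ofBijective_apply, map_sum, drinfeldTensor_tmul, Algebra.smul_def,
    mul_comm]

/-- The morphism `u ⊗ id` on algebras over the residue field. -/
noncomputable abbrev uRaResidue :
    restrictAlg O' (ResidueField O') ⋙ wittTensorFunctor O' π ⟶
      restrictAlg O' (ResidueField O') ⋙ wittFunctor ϖ :=
  Functor.whiskerLeft (restrictAlg O' (ResidueField O')) (uRa π ϖ)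

lemma seriesCoordinates_uRaResidue [NeZero e] {η : O'ˣ} (hη : algebraMap O O' π.1 = η * ϖ.1 ^ e)
    (B : CommAlgCat.{v} (ResidueField O'))
    (x : (restrictAlg O' (ResidueField O') ⋙ wittTensorFunctor O' π).obj B) (p : ℕ × Fin e) :
    (seriesCoordinates (fun j => η ^ (j / e)) ϖ (Nat.divModEquiv e) (ResidueField O')).equiv B
        ((uRaResidue π ϖ).app B x) p =
      (wittTensorCoordinates h π ϖ he (ResidueField O')).equiv B x p ^ frobeniusExponent O p := by
  let _ := Algebra.compHom B (algebraMap O' (ResidueField O'))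
  let _ := Algebra.compHom B (algebraMap O O')
  have : IsScalarTower O O' B := .of_algebraMap_eq fun _ => rfl
  have hB : algebraMap O' B ϖ.1 = 0 := by
    change algebraMap (ResidueField O') B (residue O' ϖ.1) = 0
    rw [(ϖ.dvd_iff ϖ.1).1 dvd_rfl, map_zero]
  have key (b : Fin e → RamifiedWitt π B) :
      (seriesEquiv (fun j => η ^ (j / e)) ϖ B).symm
        (drinfeldTensor π ϖ B (tensorEquiv h π ϖ he B b)) ((Nat.divModEquiv e).symm p) =
      (b p.2).coeff p.1 ^ frobeniusExponent O p := by
    rw [drinfeldTensor_tensorEquiv, sum_pow_smul_drinfeld_eq_series ϖ h hη hB, ← seriesEquiv_apply,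
      Equiv.symm_apply_apply, Equiv.apply_symm_apply]
  have hx : tensorEquiv h π ϖ he B ((tensorEquiv h π ϖ he B).symm x) = x :=
    Equiv.apply_symm_apply _ _
  exact (congrArg (fun y => (seriesEquiv (fun j => η ^ (j / e)) ϖ B).symm
    (drinfeldTensor π ϖ B y) ((Nat.divModEquiv e).symm p)) hx).symm.trans (key _)

theorem exists_coordinates_uRaResidue :
    ∃ d : Coordinates (restrictAlg O' (ResidueField O') ⋙ wittFunctor ϖ) (ℕ × Fin e),
      (∀ B, d.equiv B 0 = 0) ∧ ∀ B x p, d.equiv B ((uRaResidue π ϖ).app B x) p =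
        (wittTensorCoordinates h π ϖ he (ResidueField O')).equiv B x p ^ frobeniusExponent O p := by
  have : Module.IsTorsionFree O O' := inferInstance
  have : NeZero e := ⟨he ▸ Module.finrank_pos.ne'⟩
  obtain ⟨η, hη⟩ := h.exists_unit_mul_pow π.2 ϖ.2
  exact ⟨_, seriesCoordinates_zero _ ϖ _, seriesCoordinates_uRaResidue h π ϖ he (he ▸ hη)⟩

theorem isUniversalHomeomorphism_uRaSpecial :
    IsUniversalHomeomorphism (uRaSpecial h π ϖ he).hom.hom.left := by
  obtain ⟨d, -, hd⟩ := exists_coordinates_uRaResidue h π ϖ he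
  cases nonempty_fintype (ResidueField O')
  obtain ⟨ℓ, _, n, hℓ, hn⟩ := FiniteField.card' (ResidueField O')
  have : Fact ℓ.Prime := ⟨hℓ⟩
  have : CharP (residueRing O') ℓ := ‹CharP (ResidueField O') ℓ›
  refine Coordinates.isUniversalHomeomorphism_groupHom (R := residueRing O') hd ℓ
    (fun p => ⟨n * (p.1 * (e - 1) + p.2), ?_⟩) (wittCoordinates ϖ (ResidueField O'))
  rw [frobeniusExponent, ← h.residueCard_eq, residueCard, Nat.card_eq_fintype_card, hn, ← pow_mul]

theorem exists_kernel_uRaSpecial_iso :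
    ∃ c : PowerCoordinates (kernelFunctor (Functor.whiskerRight (uRaResidue (O' := O') π ϖ)
        addGroupFunctor)) (frobeniusExponent O (e := e)),
      c.IsTriangular (R := residueRing O') Prod.fst ∧
        Nonempty (kernel (uRaSpecial h π ϖ he) ≅
          (groupSchemeFunctor (residueRing O')).obj c.groupObj) := by
  obtain ⟨d, hd, hα⟩ := exists_coordinates_uRaResidue h π ϖ he
  exact ⟨Coordinates.kernelCoordinates (R := residueRing O') hα hd,
    (isTriangular_wittTensorCoordinates h π ϖ he (ResidueField O')).kernelCoordinates hα hd,
    ⟨Coordinates.kernelGroupHomIso (R := residueRing O') _ _ _ _⟩⟩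

theorem isProInfinitesimal_kernel_uRaSpecial :
    IsProInfinitesimal (kernel (uRaSpecial h π ϖ he)) := by
  obtain ⟨c, hc, ⟨i⟩⟩ := exists_kernel_uRaSpecial_iso h π ϖ he
  have (N : ℕ) : Finite {p : ℕ × Fin e // p.1 < N} :=
    ((Set.finite_lt_nat N).prod Set.finite_univ).subset (fun p hp => ⟨hp, trivial⟩)
  exact .of_iso i (hc.isProInfinitesimal frobeniusExponent_pos)

end RamWitt

theorem mainTheorem5_general
    {O : Type*} [CommRing O] [IsDomain O] [IsDiscreteValuationRing O]
    [Finite (IsLocalRing.ResidueField O)]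
    {O' : Type*} [CommRing O'] [IsDomain O'] [IsDiscreteValuationRing O']
    [Finite (IsLocalRing.ResidueField O')]
    [Algebra O O'] [FaithfulSMul O O'] [Module.Finite O O']
    (h : RamWitt.IsTotallyRamified O O') {e : ℕ} (he : Module.finrank O O' = e)
    (π : RamWitt.Uniformizer O) (ϖ : RamWitt.Uniformizer O') :
    RamWitt.IsUniversalHomeomorphism (RamWitt.uRaSpecial h π ϖ he).hom.hom.left ∧
    RamWitt.IsProInfinitesimal (CategoryTheory.Limits.kernel (RamWitt.uRaSpecial h π ϖ he)) ∧
    Nonempty ((CategoryTheory.Limits.kernel (RamWitt.uRaSpecial h π ϖ he)).X ≅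
      CategoryTheory.Over.mk (AlgebraicGeometry.Spec.map (CommRingCat.ofHom
        (algebraMap (IsLocalRing.ResidueField O')
          (MvPolynomial (ℕ × Fin e) (IsLocalRing.ResidueField O') ⧸
            Ideal.span (Set.range fun p : ℕ × Fin e =>
              (MvPolynomial.X p : MvPolynomial (ℕ × Fin e) (IsLocalRing.ResidueField O')) ^
                RamWitt.residueCard O ^ (p.1 * (e - 1) + p.2))))))) := by
  obtain ⟨c, -, ⟨i⟩⟩ := RamWitt.exists_kernel_uRaSpecial_iso h π ϖ he
  exact ⟨RamWitt.isUniversalHomeomorphism_uRaSpecial h π ϖ he,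
    RamWitt.isProInfinitesimal_kernel_uRaSpecial h π ϖ he,
    ⟨(CategoryTheory.Grp.forget _).mapIso i⟩⟩

theorem mainTheorem5
    {O : Type*} [CommRing O] [IsDomain O] [IsDiscreteValuationRing O]
    [IsAdicComplete (IsLocalRing.maximalIdeal O) O] [Finite (IsLocalRing.ResidueField O)]
    {O' : Type*} [CommRing O'] [IsDomain O'] [IsDiscreteValuationRing O']
    [Finite (IsLocalRing.ResidueField O')]
    [Algebra O O'] [FaithfulSMul O O'] [Module.Finite O O']
    (h : RamWitt.IsTotallyRamified O O') {e : ℕ} (he : Module.finrank O O' = e)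
    (π : RamWitt.Uniformizer O) (ϖ : RamWitt.Uniformizer O') :
    RamWitt.IsUniversalHomeomorphism (RamWitt.uRaSpecial h π ϖ he).hom.hom.left ∧
    RamWitt.IsProInfinitesimal (CategoryTheory.Limits.kernel (RamWitt.uRaSpecial h π ϖ he)) ∧
    Nonempty ((CategoryTheory.Limits.kernel (RamWitt.uRaSpecial h π ϖ he)).X ≅
      CategoryTheory.Over.mk (AlgebraicGeometry.Spec.map (CommRingCat.ofHom
        (algebraMap (IsLocalRing.ResidueField O')
          (MvPolynomial (ℕ × Fin e) (IsLocalRing.ResidueField O') ⧸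
            Ideal.span (Set.range fun p : ℕ × Fin e =>
              (MvPolynomial.X p : MvPolynomial (ℕ × Fin e) (IsLocalRing.ResidueField O')) ^
                RamWitt.residueCard O ^ (p.1 * (e - 1) + p.2))))))) :=
  mainTheorem5_general h he π ϖ
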